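/- Let $p,q\ge 1$ be integers and, for $\lambda\in\mathbb C\setminus\{0\}$, let $f_\lambda(z)=\lambda\tan^p(z^q)$ with free asymptotic value $v_\lambda=i^p\lambda$. A cycle is called attracting if its multiplier $\mu$ satisfies $0<|\mu|<1$. A shell component is a connected component of the set of all $\lambda\neq0$ for which $v_\lambda$ is attracted to an attracting cycle of $f_\lambda$ that attracts no critical value of $f_\lambda$. Let $\mathcal S_1$ be the set of shell components $\Omega$ such that for every $\lambda\in\Omega$: $f_\lambda$ has an attracting fixed point, if $pq$ is even; $f_\lambda$ has exactly one attracting cycle of period $2$ or exactly two attracting fixed points, if $pq$ is odd. Let $\eta_k^+$ and $\eta_k^-$, $k=0,\dots,q-1$, be the $q$ distinct roots of $\eta^q=i$ and of $\eta^q=-i$ respectively, labeled so that $\eta_k^-=-\eta_k^+$ if $q$ is odd and $\eta_k^-=\overline{\eta_k^+}$ if $q$ is even. Let $\ell_k^\pm=\{s\,i^{-p}\eta_k^\pm : s>0\}$, so that $v_\lambda=s\eta_k^\pm$ with $s>0$ for $\lambda\in\ell_k^\pm$. Theorem. The set $\mathcal S_1$ consists of exactly $2q$ distinct components $\Omega_k^{\pm}$,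 $k=0,\dots,q-1$. Each is unbounded, and $\Omega_k^\pm$ is symmetric about the ray $\ell_k^\pm$: it meets $\ell_k^\pm$ and is invariant under the reflection in the line containing $\ell_k^\pm$. Moreover: (i) If $p$ is even, then for $\lambda\in\ell_k^\pm\cap\Omega_k^\pm$ the function $f_\lambda$ has a single attracting fixed point $z_\lambda$, and $\arg z_\lambda=\arg v_\lambda$. (ii) If $p$ is odd and $q$ is even, then for $\lambda\in\ell_k^\pm\cap\Omega_k^\pm$ the function $f_\lambda$ has a single attracting fixed point $z_\lambda$; $\arg z_\lambda=\arg v_\lambda$ if $\lambda\in\ell_k^+\cap\Omega_k^+$, and $\arg z_\lambda=\arg(-v_\lambda)$ if $\lambda\in\ell_k^-\cap\Omega_k^-$. (iii) If $pq$ is odd and $\lambda\in\ell_k^+\cap\Omega_k^+$, then $f_\lambda$ has exactly two attracting fixed points, $z_\lambda$ and $-z_\lambda$; they lie on the open rays from $0$ in the directions $\eta_k^+$ and $\eta_k^-$ and attract $v_\lambda$ and $-v_\lambda$ respectively. If $pq$ is odd and $\lambda\in\ell_k^-\cap\Omega_k^-$, then $f_\lambda$ has exactly one attracting cycle of period two;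 it is of the form $\{z_\lambda,-z_\lambda\}$, it attracts both $v_\lambda$ and $-v_\lambda$, and its points can be labeled so that $\arg z_\lambda=\arg v_\lambda$. -/

import Mathlib

open Filter Topology

noncomputable section

namespace TanFamily

/-- The function `f_l(z) = l * tan^p (z^q)`. Its poles are the points where `cos (z^q) = 0`;
the value that Lean assigns there is never used: the notions below only look at orbits that
avoid the poles. -/
def f (p q : ℕ) (l z : ℂ) : ℂ := l * Complex.tan (z ^ q) ^ p

/-- The whole forward orbit of `z` is defined, that is, it contains no pole of `f_l`. -/
def OrbitDefined (p q : ℕ) (l z : ℂ) : Prop :=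
  ∀ m : ℕ, Complex.cos (((f p q l)^[m] z) ^ q) ≠ 0

/-- `z` is a periodic point of `f_l` of exact period `n`, and it is attracting: its multiplier
`μ` satisfies `0 < |μ| < 1` (so superattracting points are not included). -/
structure IsAttractingPoint (p q : ℕ) (l : ℂ) (n : ℕ) (z : ℂ) : Prop where
  period_pos : 0 < n
  orbit_defined : OrbitDefined p q l z
  period_eq : Function.minimalPeriod (f p q l) z = n
  multiplier_ne_zero : deriv ((f p q l)^[n]) z ≠ 0
  multiplier_lt_one : ‖deriv ((f p q l)^[n]) z‖ < 1

/-- `C` is (the set of points of) an attracting cycle of `f_l` of period `n`. -/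
def IsAttractingCycle (p q : ℕ) (l : ℂ) (n : ℕ) (C : Set ℂ) : Prop :=
  ∃ z : ℂ, IsAttractingPoint p q l n z ∧ C = Set.range fun m : ℕ => (f p q l)^[m] z

/-- The point `w` is attracted to the cycle `C`: its orbit is defined and converges to `C`. -/
def AttractedTo (p q : ℕ) (l w : ℂ) (C : Set ℂ) : Prop :=
  OrbitDefined p q l w ∧
    Tendsto (fun m : ℕ => Metric.infDist ((f p q l)^[m] w) C) atTop (𝓝 0)

/-- The free asymptotic value `v_l = i^p l`. -/
def freeValue (p : ℕ) (l : ℂ) : ℂ := Complex.I ^ p * l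

/-- The critical values of `f_l`; these are its dynamically fixed singular values. -/
def criticalValues (p q : ℕ) (l : ℂ) : Set ℂ :=
  {w | ∃ c : ℂ, Complex.cos (c ^ q) ≠ 0 ∧ deriv (f p q l) c = 0 ∧ f p q l c = w}

/-- The shell parameters: those `l ≠ 0` for which the free asymptotic value is attracted to an
attracting cycle that attracts none of the dynamically fixed singular values. -/
def shellLocus (p q : ℕ) : Set ℂ :=
  {l | l ≠ 0 ∧ ∃ (n : ℕ) (C : Set ℂ), IsAttractingCycle p q l n C ∧
    AttractedTo p q l (freeValue p l) C ∧
    ∀ w ∈ criticalValues p q l, ¬ AttractedTo p q l w C}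

/-- The condition on `f_l` that defines the class `S_n`. If `pq` is even: there is an attracting
cycle of period `n`. If `pq` is odd: there is one attracting cycle of period `2n`, or there are
two attracting cycles of period `n`. -/
def HasShellPeriod (p q n : ℕ) (l : ℂ) : Prop :=
  (Even (p * q) → ∃ C : Set ℂ, IsAttractingCycle p q l n C) ∧
  (Odd (p * q) →
    {C : Set ℂ | IsAttractingCycle p q l (2 * n) C}.ncard = 1 ∨
    {C : Set ℂ | IsAttractingCycle p q l n C}.ncard = 2)

/-- `S_n`: the set of the shell components (the connected components of the set of shell
parameters) of period `n`. -/
def shellComponents (p q n : ℕ) : Set (Set ℂ) :=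
  {Ω | (∃ l₀ ∈ shellLocus p q, Ω = connectedComponentIn (shellLocus p q) l₀) ∧
    ∀ l ∈ Ω, HasShellPeriod p q n l}

/-- The open ray from the origin in the direction `d`. -/
def ray (d : ℂ) : Set ℂ := {l | ∃ s : ℝ, 0 < s ∧ l = (s : ℂ) * d}

/-- The reflection of the plane in the line spanned by `d ≠ 0`. -/
def reflect (d l : ℂ) : ℂ := d / (starRingEnd ℂ) d * (starRingEnd ℂ) l

/-- The ray in the parameter plane in the direction `i^{-p} η`. -/
def axis (p : ℕ) (η : ℂ) : Set ℂ := ray ((Complex.I ^ p)⁻¹ * η)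

/-- `Ω` is symmetric about the ray `axis p η`: it meets the ray, and it is invariant under the
reflection in the line that contains the ray. -/
def SymmetricAboutAxis (p : ℕ) (η : ℂ) (Ω : Set ℂ) : Prop :=
  (Ω ∩ axis p η).Nonempty ∧ reflect ((Complex.I ^ p)⁻¹ * η) '' Ω = Ω

end TanFamily

end

/-! ### Attraction to cycles: contraction near an attracting point, uniform in the parameter. -/

namespace TanFamily

open Metric Set

variable {p q n : ℕ} {l z w : ℂ} {C D : Set ℂ}

/-! Write `z ^ q = e * I * W` with `e = ±1` and `Re W > 0`, so that `z = η W^{1/q}` with `η ^ q = e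
* I`. Since `tan (iW) = i tanh W`, the equation `f_λ z = e ^ p * z` says `λ = i^{-p} η W^{1/q} /
tanh^p W`, and then `|f_λ' z| = 2pq|W| / |sinh 2W|`. Hence the parameters with a nonzero attracting
fixed point or, for `pq` odd, an attracting cycle `{z, -z}`, fill the sets `shellRegion p q η`, one
for each of the `2q` directions `η`. Up to rotation they are all the image of one domain,
`attractingRegion`, under one holomorphic map. The domain is connected because its points can be
pushed to the right; the map is open and sends bounded values back to bounded points; both commute
with conjugation. So each region is open, connected, unbounded and symmetric about its axis.

Each region lies in the shell locus by Fatou's argument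
(`IsAttractingPoint.attractedTo_asymptotic_value`): an attracting cycle whose basin misses a disc
attracts an asymptotic value. The symmetries of `f` reduce the asymptotic values to `v`, or to `±v`
when `pq` is odd, which also makes the attracting cycle unique up to sign.

Each region is relatively closed in the shell locus (`closure_shellRegion_inter_subset`). At a limit
parameter outside the region the limit of the cycles is neutral. If `v` were attracted there to an
attracting cycle, it would stay near that cycle for all nearby parameters
(`AttractedTo.eventually_near`), so that cycle would consist of points of the neutral limit, which
is absurd. An open, connected, relatively closed subset is a component.

The regions are distinct because the cycle that attracts `v` determines `η`. On the axis, `W` and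
its conjugate give the same parameter, so uniqueness forces `W^{1/q}` to be real; this gives all the
arguments. -/

theorem f_zero (hp : 1 ≤ p) (hq : 1 ≤ q) : f p q l 0 = 0 := by
  simp [f, zero_pow (by lia : q ≠ 0), zero_pow (by lia : p ≠ 0)]

theorem iterate_f_zero (hp : 1 ≤ p) (hq : 1 ≤ q) (m : ℕ) : (f p q l)^[m] 0 = 0 :=
  Function.iterate_fixed (f_zero hp hq) m

/-- The points of the forward orbit of `z`. -/
def orbit (p q : ℕ) (l z : ℂ) : Set ℂ := Set.range fun m : ℕ => (f p q l)^[m] z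

/-- Differentiability is joint in parameter and point so that a single linear estimate controls the
dynamics of all nearby parameters. -/
theorem differentiableAt_iterate_prod (m : ℕ)
    (h : ∀ j < m, Complex.cos (((f p q l)^[j] z) ^ q) ≠ 0) :
    DifferentiableAt ℂ (fun x : ℂ × ℂ => (f p q x.1)^[m] x.2) (l, z) := by
  induction m with
  | zero => simp
  | succ m ih =>
    simp only [Function.iterate_succ_apply']
    have h1 := ih fun j hj => h j (by lia)
    have h2 : DifferentiableAt ℂ (fun x : ℂ × ℂ => ((f p q x.1)^[m] x.2) ^ q) (l, z) := h1.pow q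
    have h3 : DifferentiableAt ℂ
        (fun x : ℂ × ℂ => Complex.tan (((f p q x.1)^[m] x.2) ^ q)) (l, z) :=
      DifferentiableAt.comp (l, z) (g := Complex.tan)
        (Complex.differentiableAt_tan.2 (h m (by lia))) h2
    exact differentiableAt_fst.mul (h3.pow p)

theorem differentiableAt_iterate (m : ℕ)
    (h : ∀ j < m, Complex.cos (((f p q l)^[j] z) ^ q) ≠ 0) :
    DifferentiableAt ℂ ((f p q l)^[m]) z :=
  DifferentiableAt.comp z (f := fun w : ℂ => (l, w)) (differentiableAt_iterate_prod m h)
    ((differentiableAt_const l).prodMk differentiableAt_id)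

/-- First-order expansion of `(l', w) ↦ f_{l'}^n w` at `(l, z)`. The centre `z` is kept while the
parameter moves, so the periodic point need not be continued; the term `K * ‖l' - l‖` pays for this.
-/
theorem exists_contraction (ho : OrbitDefined p q l z) (hz : (f p q l)^[n] z = z)
    (hd : ‖deriv ((f p q l)^[n]) z‖ < 1) :
    ∃ r > 0, ∃ c < 1, 0 ≤ c ∧ ∃ K > 0, ∀ l' w : ℂ, ‖l' - l‖ < r → ‖w - z‖ < r →
      ‖(f p q l')^[n] w - z‖ ≤ c * ‖w - z‖ + K * ‖l' - l‖ := by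
  have hF := (differentiableAt_iterate_prod n fun j _ => ho j).hasFDerivAt
  set F' := fderiv ℂ (fun x : ℂ × ℂ => (f p q x.1)^[n] x.2) (l, z)
  have h01 : F' (0, 1) = deriv ((f p q l)^[n]) z := by
    have := (hF.comp_hasDerivAt (f := fun w : ℂ => (l, w)) z
      ((hasDerivAt_const z l).prodMk (hasDerivAt_id z))).deriv
    exact this.symm
  set μ := ‖deriv ((f p q l)^[n]) z‖
  -- With this error, the contraction factor `μ + ε` is the midpoint of `μ` and `1`.
  set ε := (1 - μ) / 2 with hε
  have hε0 : 0 < ε := by simp only [hε]; linarith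
  have hlo := hF.isLittleO.bound hε0
  obtain ⟨r, hr, hb⟩ := Metric.eventually_nhds_iff.1 hlo
  refine ⟨r, hr, μ + ε, by simp only [hε]; linarith, by positivity, ‖F' (1, 0)‖ + ε,
    by positivity, fun l' w hl hw => ?_⟩
  have hx : dist (l', w) (l, z) < r := by
    rw [Prod.dist_eq, max_lt_iff, dist_eq_norm, dist_eq_norm]; exact ⟨hl, hw⟩
  have h1 := hb hx
  simp only [hz] at h1
  have h2 : F' ((l', w) - (l, z)) = (l' - l) * F' (1, 0) + (w - z) * F' (0, 1) := by
    rw [← smul_eq_mul, ← smul_eq_mul, ← map_smul, ← map_smul, ← map_add]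
    congr 1
    simp
  have h3 : ‖((l', w) - (l, z) : ℂ × ℂ)‖ ≤ ‖l' - l‖ + ‖w - z‖ := by
    rw [Prod.mk_sub_mk, Prod.norm_mk]
    exact max_le (by linarith [norm_nonneg (w - z)]) (by linarith [norm_nonneg (l' - l)])
  have h4 : (f p q l')^[n] w - z = ((f p q l')^[n] w - z - F' ((l', w) - (l, z)))
      + ((l' - l) * F' (1, 0) + (w - z) * F' (0, 1)) := by rw [h2]; ring
  rw [h4]
  calc _ ≤ ‖(f p q l')^[n] w - z - F' ((l', w) - (l, z))‖
        + (‖(l' - l) * F' (1, 0)‖ + ‖(w - z) * F' (0, 1)‖) :=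
        (norm_add_le _ _).trans (add_le_add_right (norm_add_le _ _) _)
    _ ≤ ε * (‖l' - l‖ + ‖w - z‖) + (‖l' - l‖ * ‖F' (1, 0)‖ + ‖w - z‖ * μ) := by
        rw [norm_mul, norm_mul, h01]
        gcongr
        exact h1.trans (by gcongr)
    _ = _ := by ring

theorem orbitDefined_of_map (hw : Complex.cos (w ^ q) ≠ 0) (h : OrbitDefined p q l (f p q l w)) :
    OrbitDefined p q l w := by
  intro m
  cases m with
  | zero => exact hw
  | succ m => exact h m

theorem attractedTo_of_map (hw : Complex.cos (w ^ q) ≠ 0) (h : AttractedTo p q l (f p q l w) C) :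
    AttractedTo p q l w C :=
  ⟨orbitDefined_of_map hw h.1, (tendsto_add_atTop_iff_nat 1).1 h.2⟩

theorem OrbitDefined.iterate (h : OrbitDefined p q l w) (k : ℕ) :
    OrbitDefined p q l ((f p q l)^[k] w) := fun m => by
  rw [← Function.iterate_add_apply]; exact h _

theorem AttractedTo.iterate (h : AttractedTo p q l w C) (k : ℕ) :
    AttractedTo p q l ((f p q l)^[k] w) C :=
  ⟨h.1.iterate k, by simpa only [← Function.iterate_add_apply] using
    (tendsto_add_atTop_iff_nat (f := fun m => infDist ((f p q l)^[m] w) C) k).2 h.2⟩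

theorem AttractedTo.mono (h : AttractedTo p q l w C) (hC : C.Nonempty) (hCD : C ⊆ D) :
    AttractedTo p q l w D :=
  ⟨h.1, squeeze_zero (fun _ => infDist_nonneg) (fun _ => infDist_le_infDist_of_subset hCD hC) h.2⟩

theorem AttractedTo.inter_nonempty (h : AttractedTo p q l w C) (h' : AttractedTo p q l w D)
    (hC : C.Finite) (hD : D.Finite) (hC0 : C.Nonempty) (hD0 : D.Nonempty) : (C ∩ D).Nonempty := by
  by_contra hn
  obtain ⟨δ, hδ, hdis⟩ := (Set.disjoint_iff_inter_eq_empty.2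
    (Set.not_nonempty_iff_eq_empty.1 hn)).exists_thickenings hC.isCompact hD.isClosed
  obtain ⟨m, h1, h2⟩ := ((h.2.eventually (gt_mem_nhds hδ)).and
    (h'.2.eventually (gt_mem_nhds hδ))).exists
  exact Set.disjoint_left.1 hdis ((mem_thickening_iff_infDist_lt hC0).2 h1)
    ((mem_thickening_iff_infDist_lt hD0).2 h2)

theorem orbit_nonempty : (orbit p q l z).Nonempty := Set.range_nonempty _

theorem self_mem_orbit : z ∈ orbit p q l z := ⟨0, rfl⟩

theorem orbit_of_fixed (h : f p q l z = z) : orbit p q l z = {z} := by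
  ext w
  simp only [orbit, Set.mem_range, Function.iterate_fixed h, exists_const, mem_singleton_iff]
  exact eq_comm

theorem mem_orbit_iff (hn : 0 < n) (hz : (f p q l)^[n] z = z) :
    w ∈ orbit p q l z ↔ ∃ j < n, (f p q l)^[j] z = w := by
  constructor
  · rintro ⟨m, rfl⟩
    exact ⟨m % n, Nat.mod_lt _ hn, Function.IsPeriodicPt.iterate_mod_apply (n := n) hz m⟩
  · rintro ⟨j, -, rfl⟩
    exact ⟨j, rfl⟩

theorem finite_orbit (hn : 0 < n) (hz : (f p q l)^[n] z = z) : (orbit p q l z).Finite := by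
  refine ((Set.finite_lt_nat n).image fun m => (f p q l)^[m] z).subset fun w hw => ?_
  obtain ⟨j, hj, rfl⟩ := (mem_orbit_iff hn hz).1 hw
  exact ⟨j, hj, rfl⟩

theorem orbit_iterate (hn : 0 < n) (hz : (f p q l)^[n] z = z) (k : ℕ) :
    orbit p q l ((f p q l)^[k] z) = orbit p q l z := by
  apply Set.Subset.antisymm
  · rintro _ ⟨m, rfl⟩
    exact ⟨m + k, Function.iterate_add_apply _ _ _ _⟩
  · rintro _ ⟨m, rfl⟩
    refine ⟨m + (n * k - k), ?_⟩
    have h1 : (f p q l)^[n * k] z = z := by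
      rw [Function.iterate_mul]; exact Function.iterate_fixed hz k
    have h2 : k ≤ n * k := Nat.le_mul_of_pos_left k hn
    simp only
    rw [← Function.iterate_add_apply, (by lia : m + (n * k - k) + k = m + n * k),
      Function.iterate_add_apply, h1]

theorem orbit_eq_of_mem (hn : 0 < n) (hz : (f p q l)^[n] z = z) (h : w ∈ orbit p q l z) :
    orbit p q l w = orbit p q l z := by
  obtain ⟨k, rfl⟩ := h
  exact orbit_iterate hn hz k

namespace IsAttractingPoint

variable {k : ℕ} {z' : ℂ}

theorem iterate_eq (h : IsAttractingPoint p q l n z) : (f p q l)^[n] z = z := by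
  have := Function.iterate_minimalPeriod (f := f p q l) (x := z)
  rwa [h.period_eq] at this

theorem finite_orbit (h : IsAttractingPoint p q l n z) : (orbit p q l z).Finite :=
  TanFamily.finite_orbit h.period_pos h.iterate_eq

theorem orbit_eq (h : IsAttractingPoint p q l n z) (h' : IsAttractingPoint p q l k z')
    (hw : AttractedTo p q l w (orbit p q l z)) (hw' : AttractedTo p q l w (orbit p q l z')) :
    orbit p q l z = orbit p q l z' := by
  obtain ⟨x, hx, hx'⟩ := hw.inter_nonempty hw' h.finite_orbit h'.finite_orbit
    orbit_nonempty orbit_nonempty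
  rw [← orbit_eq_of_mem h.period_pos h.iterate_eq hx,
    orbit_eq_of_mem h'.period_pos h'.iterate_eq hx']

end IsAttractingPoint

/-- The multiplier may vanish and `n` need not be the exact period, so that the superattracting
fixed point `0` is covered too. -/
theorem exists_ball_attractedTo (hn : 0 < n) (ho : OrbitDefined p q l z)
    (hz : (f p q l)^[n] z = z) (hd : ‖deriv ((f p q l)^[n]) z‖ < 1) :
    ∃ R > 0, ∀ w ∈ ball z R, AttractedTo p q l w (orbit p q l z) := by
  obtain ⟨r, hr, c, hc1, hc0, K, -, hb⟩ := exists_contraction ho hz hd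
  have hcont : ∀ j, ContinuousAt ((f p q l)^[j]) z := fun j =>
    (differentiableAt_iterate j fun i _ => ho i).continuousAt
  have hcos : ∀ᶠ x in 𝓝 z, ∀ j ∈ Finset.range n, Complex.cos (((f p q l)^[j] x) ^ q) ≠ 0 := by
    rw [Filter.eventually_all_finset]
    intro j _
    exact ((Complex.continuous_cos.continuousAt).comp ((hcont j).pow q)).eventually_ne (ho j)
  obtain ⟨R, hR, hRcos⟩ := Metric.eventually_nhds_iff.1 hcos
  refine ⟨min r R, lt_min hr hR, fun w hw => ?_⟩
  have hw1 : ‖w - z‖ < r := by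
    rw [← dist_eq_norm]; exact (mem_ball.1 hw).trans_le (min_le_left _ _)
  have hw2 : ‖w - z‖ < R := by
    rw [← dist_eq_norm]; exact (mem_ball.1 hw).trans_le (min_le_right _ _)
  have hgeo : ∀ k, ‖(f p q l)^[n * k] w - z‖ ≤ c ^ k * ‖w - z‖ := by
    intro k
    induction k with
    | zero => simp
    | succ k ih =>
      have h1 : ‖(f p q l)^[n * k] w - z‖ ≤ ‖w - z‖ :=
        ih.trans (mul_le_of_le_one_left (norm_nonneg _) (pow_le_one₀ hc0 hc1.le))
      have h2 := hb l _ (by simpa using hr) (h1.trans_lt hw1)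
      rw [mul_add, mul_one, add_comm, Function.iterate_add_apply]
      calc _ ≤ c * ‖(f p q l)^[n * k] w - z‖ := by simpa using h2
        _ ≤ c * (c ^ k * ‖w - z‖) := by gcongr
        _ = _ := by ring
  have hlim : Tendsto (fun k => (f p q l)^[n * k] w) atTop (𝓝 z) := by
    rw [tendsto_iff_norm_sub_tendsto_zero]
    refine squeeze_zero (fun _ => norm_nonneg _) hgeo ?_
    simpa using (tendsto_pow_atTop_nhds_zero_of_lt_one hc0 hc1).mul_const ‖w - z‖
  have hsplit : ∀ m, (f p q l)^[m] w = (f p q l)^[m % n] ((f p q l)^[n * (m / n)] w) := fun m => by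
    rw [← Function.iterate_add_apply, Nat.mod_add_div]
  refine ⟨fun m => ?_, ?_⟩
  · rw [hsplit]
    refine hRcos ?_ _ (Finset.mem_range.2 (Nat.mod_lt _ hn))
    rw [dist_eq_norm]
    exact ((hgeo _).trans (mul_le_of_le_one_left (norm_nonneg _)
      (pow_le_one₀ hc0 hc1.le))).trans_lt hw2
  · rw [Metric.tendsto_atTop]
    intro ε hε
    have hev : ∀ᶠ x in 𝓝 z, ∀ j ∈ Finset.range n,
        dist ((f p q l)^[j] x) ((f p q l)^[j] z) < ε := by
      rw [Filter.eventually_all_finset]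
      exact fun j _ => (Metric.tendsto_nhds.1 (hcont j)) ε hε
    obtain ⟨k₀, hk₀⟩ := Filter.eventually_atTop.1 (hlim.eventually hev)
    refine ⟨n * k₀, fun m hm => ?_⟩
    rw [Real.dist_eq, sub_zero, abs_of_nonneg infDist_nonneg, hsplit]
    refine (infDist_le_dist_of_mem
      (show (f p q l)^[m % n] z ∈ orbit p q l z from ⟨m % n, rfl⟩)).trans_lt ?_
    exact hk₀ _ ((Nat.le_div_iff_mul_le hn).2 (by lia)) _ (Finset.mem_range.2 (Nat.mod_lt _ hn))

/-- If the orbit of `w` approaches the cycle of `z`, then some iterate is arbitrarily close to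
`z` itself. -/
theorem AttractedTo.exists_iterate_near (hw : AttractedTo p q l w (orbit p q l z)) (hn : 0 < n)
    (ho : OrbitDefined p q l z) (hz : (f p q l)^[n] z = z) {r : ℝ} (hr : 0 < r) :
    ∃ m, ‖(f p q l)^[m] w - z‖ < r := by
  have key : ∀ j ∈ Finset.range n, ∃ δ > 0, ∀ x, dist x ((f p q l)^[j] z) < δ →
      dist ((f p q l)^[n - j] x) z < r := by
    intro j hj
    have h1 : ContinuousAt ((f p q l)^[n - j]) ((f p q l)^[j] z) :=
      (differentiableAt_iterate _ fun i _ => (ho.iterate j) i).continuousAt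
    have h2 : (f p q l)^[n - j] ((f p q l)^[j] z) = z := by
      rw [← Function.iterate_add_apply, Nat.sub_add_cancel (Finset.mem_range.1 hj).le, hz]
    have h3 := (Metric.tendsto_nhds.1 h1) r hr
    rw [h2] at h3
    exact Metric.eventually_nhds_iff.1 h3
  choose! δ hδ hδ' using key
  have hne : (Finset.range n).Nonempty := ⟨0, Finset.mem_range.2 hn⟩
  obtain ⟨j₀, hj₀, hmin⟩ := Finset.exists_min_image (Finset.range n) δ hne
  obtain ⟨m, hm⟩ := (hw.2.eventually (gt_mem_nhds (hδ j₀ hj₀))).exists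
  obtain ⟨c, hc, hcd⟩ := (infDist_lt_iff orbit_nonempty).1 hm
  obtain ⟨j, hj, rfl⟩ := (mem_orbit_iff hn hz).1 hc
  have hj' := Finset.mem_range.2 hj
  refine ⟨n - j + m, ?_⟩
  rw [← dist_eq_norm, Function.iterate_add_apply]
  exact hδ' j hj' _ (hcd.trans_le (hmin j hj'))

/-- Near a parameter for which `w` is attracted to the cycle of `z`, the orbit of `w` returns
to a small disc around `z` once in every period. -/
theorem AttractedTo.eventually_near {v : ℂ → ℂ} (hv : ContinuousAt v l)
    (hw : AttractedTo p q l (v l) (orbit p q l z)) (hn : 0 < n) (ho : OrbitDefined p q l z)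
    (hz : (f p q l)^[n] z = z) (hd : ‖deriv ((f p q l)^[n]) z‖ < 1) {r : ℝ} (hr : 0 < r) :
    ∃ m, ∀ᶠ l' in 𝓝 l, ∀ k, ‖(f p q l')^[n * k + m] (v l') - z‖ ≤ r := by
  obtain ⟨r₀, hr₀, c, hc1, hc0, K, hK, hb⟩ := exists_contraction ho hz hd
  set s := min r (r₀ / 2) with hs
  have hs0 : 0 < s := lt_min hr (by positivity)
  have hsr : s < r₀ := (min_le_right _ _).trans_lt (by linarith)
  obtain ⟨m, hm⟩ := hw.exists_iterate_near hn ho hz hs0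
  have hcont : ContinuousAt (fun l' => (f p q l')^[m] (v l')) l :=
    ContinuousAt.comp (f := fun l' => (l', v l')) (g := fun x : ℂ × ℂ => (f p q x.1)^[m] x.2)
      (differentiableAt_iterate_prod m fun j _ => hw.1 j).continuousAt (continuousAt_id.prodMk hv)
  have h1 : ∀ᶠ l' in 𝓝 l, ‖(f p q l')^[m] (v l') - z‖ < s :=
    (hcont.sub continuousAt_const).norm.eventually (gt_mem_nhds hm)
  -- This makes the drift at most `(1 - c) * s`, so that the ball of radius `s` about `z` is mapped
  -- into itself by the `n`-th iterate.
  have h2 : ∀ᶠ l' in 𝓝 l, ‖l' - l‖ < min r₀ ((1 - c) * s / K) := by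
    have h0 : 0 < min r₀ ((1 - c) * s / K) :=
      lt_min hr₀ (div_pos (mul_pos (by linarith) hs0) hK)
    filter_upwards [Metric.ball_mem_nhds l h0] with l' hl'
    rwa [mem_ball, dist_eq_norm] at hl'
  refine ⟨m, ?_⟩
  filter_upwards [h1, h2] with l' h1 h2 k
  have h3 : K * ‖l' - l‖ ≤ (1 - c) * s := by
    have := (h2.trans_le (min_le_right _ _)).le
    rw [le_div_iff₀ hK] at this
    linarith
  suffices ‖(f p q l')^[n * k + m] (v l') - z‖ ≤ s from this.trans (min_le_left _ _)
  induction k with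
  | zero => simpa using h1.le
  | succ k ih =>
    have := hb l' _ (h2.trans_le (min_le_left _ _)) (ih.trans_lt hsr)
    rw [(by ring : n * (k + 1) + m = n + (n * k + m)), Function.iterate_add_apply]
    calc _ ≤ c * ‖(f p q l')^[n * k + m] (v l') - z‖ + K * ‖l' - l‖ := this
      _ ≤ c * s + (1 - c) * s := by gcongr
      _ = s := by ring

end TanFamily

/-! ### Inverse branches of `f` on discs, and Fatou's theorem on asymptotic values. -/

namespace TanFamily

open Metric Set

variable {p q n : ℕ} {l z w : ℂ} {C D : Set ℂ}

/-- Take for `L` the primitive of `G' / G` with value `a` at the centre; then `G * exp (-L)` has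
derivative zero. -/
theorem exists_log_on_ball {c a : ℂ} {R : ℝ} {G : ℂ → ℂ} (hR : 0 < R)
    (hG : DifferentiableOn ℂ G (ball c R)) (h0 : ∀ t ∈ ball c R, G t ≠ 0)
    (ha : Complex.exp a = G c) :
    ∃ L : ℂ → ℂ, DifferentiableOn ℂ L (ball c R) ∧ L c = a ∧
      ∀ t ∈ ball c R, Complex.exp (L t) = G t := by
  have hd : DifferentiableOn ℂ (fun t => deriv G t / G t) (ball c R) :=
    (hG.deriv isOpen_ball).div hG h0
  obtain ⟨L, hL⟩ := hd.isExactOn_ball.with_val_at c a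
  have hc : c ∈ ball c R := mem_ball_self hR
  have hder : ∀ t ∈ ball c R, HasDerivAt (fun t => G t * Complex.exp (-L t)) 0 t := by
    intro t ht
    have h1 := (hG.differentiableAt (isOpen_ball.mem_nhds ht)).hasDerivAt
    have h2 := h1.mul (hL.2 t ht).neg.cexp
    refine h2.congr_deriv ?_
    have := h0 t ht
    simp only [Pi.neg_apply]
    field_simp
    ring
  have hconst : ∀ t ∈ ball c R, G t * Complex.exp (-L t) = 1 := by
    intro t ht
    have := (convex_ball c R).is_const_of_fderivWithin_eq_zero (𝕜 := ℂ)
      (f := fun t => G t * Complex.exp (-L t))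
      (fun t ht => (hder t ht).differentiableAt.differentiableWithinAt)
      (fun t ht => by
        rw [fderivWithin_of_isOpen isOpen_ball ht]
        have := (hder t ht).hasFDerivAt.fderiv
        simpa using this) ht hc
    rw [this, hL.1, ← ha, ← Complex.exp_add]
    simp
  refine ⟨L, fun t ht => (hL.2 t ht).differentiableAt.differentiableWithinAt, hL.1,
    fun t ht => ?_⟩
  have := hconst t ht
  rw [Complex.exp_neg, ← div_eq_mul_inv, div_eq_one_iff_eq (Complex.exp_ne_zero _)] at this
  exact this.symm

/-- The alternative `k = 1` serves the case `p = q = 1`, in which `0` is not a critical value and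
the function to be lifted may vanish. -/
theorem exists_root_on_ball {c a : ℂ} {R : ℝ} {G : ℂ → ℂ} {k : ℕ} (hk : 1 ≤ k) (hR : 0 < R)
    (hG : DifferentiableOn ℂ G (ball c R)) (h0 : k = 1 ∨ ∀ t ∈ ball c R, G t ≠ 0)
    (ha : a ^ k = G c) :
    ∃ u : ℂ → ℂ, DifferentiableOn ℂ u (ball c R) ∧ u c = a ∧ ∀ t ∈ ball c R, u t ^ k = G t := by
  rcases h0 with rfl | h0
  · exact ⟨G, hG, by simpa using ha.symm, fun t _ => pow_one _⟩
  have hk0 : (k : ℂ) ≠ 0 := by exact_mod_cast (by lia : k ≠ 0)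
  have ha0 : a ≠ 0 := by
    rintro rfl
    exact h0 c (mem_ball_self hR) (by rw [← ha, zero_pow (by lia)])
  have hlog : Complex.exp (k * Complex.log a) = G c := by
    rw [Complex.exp_nat_mul, Complex.exp_log ha0, ha]
  obtain ⟨L, hL, hLc, hLe⟩ := exists_log_on_ball hR hG h0 hlog
  refine ⟨fun t => Complex.exp (L t / k), (hL.div_const _).cexp, ?_, fun t ht => ?_⟩
  · simp only [hLc, mul_div_cancel_left₀ _ hk0, Complex.exp_log ha0]
  · rw [← Complex.exp_nat_mul, mul_div_cancel₀ _ hk0, hLe t ht]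

/-- The cleared form of `exp (2iH) = (1 + iu) / (1 - iu)` also excludes poles: at a pole `exp (2iH)
= -1`, and the equation becomes `2 = 0`. -/
theorem tan_eq_of_exp {H u : ℂ} (h : Complex.exp (2 * Complex.I * H) * (1 - Complex.I * u)
    = 1 + Complex.I * u) : Complex.cos H ≠ 0 ∧ Complex.tan H = u := by
  have hE : Complex.exp (2 * Complex.I * H) = Complex.exp (H * Complex.I) ^ 2 := by
    rw [← Complex.exp_nat_mul]; congr 1; push_cast; ring
  rw [hE] at h
  set E := Complex.exp (H * Complex.I) with hEd
  have hE0 : E ≠ 0 := Complex.exp_ne_zero _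
  have hneg : Complex.exp (-H * Complex.I) = E⁻¹ := by
    rw [neg_mul, Complex.exp_neg]
  have hcos : Complex.cos H = (E + E⁻¹) / 2 := by rw [Complex.cos, hneg]
  have hsin : Complex.sin H = (E⁻¹ - E) * Complex.I / 2 := by rw [Complex.sin, hneg]
  have h1 : E ^ 2 + 1 ≠ 0 := by
    intro h1
    have h2 : E ^ 2 = -1 := by linear_combination h1
    rw [h2] at h
    have : (2 : ℂ) = 0 := by linear_combination -h
    norm_num at this
  have hc : Complex.cos H ≠ 0 := by
    rw [hcos]
    have : (E + E⁻¹) / 2 = (E ^ 2 + 1) / (2 * E) := by field_simp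
    rw [this]
    exact div_ne_zero h1 (mul_ne_zero two_ne_zero hE0)
  refine ⟨hc, ?_⟩
  rw [Complex.tan_eq_sin_div_cos, div_eq_iff hc, hcos, hsin]
  field_simp
  linear_combination -Complex.I * h - u * (E ^ 2 + 1) * Complex.I_sq

theorem exp_mul_of_tan {H : ℂ} (h : Complex.cos H ≠ 0) :
    Complex.exp (2 * Complex.I * H) * (1 - Complex.I * Complex.tan H)
      = 1 + Complex.I * Complex.tan H := by
  have hE : Complex.exp (2 * Complex.I * H) = Complex.exp (H * Complex.I) ^ 2 := by
    rw [← Complex.exp_nat_mul]; congr 1; push_cast; ring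
  have h1 := Complex.sin_sq_add_cos_sq H
  rw [hE, Complex.exp_mul_I, Complex.tan_eq_sin_div_cos]
  field_simp
  linear_combination (Complex.cos H + Complex.sin H * Complex.I) * h1
    - (Complex.cos H * Complex.sin H ^ 2 + Complex.sin H ^ 3 * Complex.I) * Complex.I_sq

/-- A holomorphic function on a disc that avoids the asymptotic values of `f`, and its
critical value if there is one, lifts through `f`. -/
theorem exists_lift (hp : 1 ≤ p) (hq : 1 ≤ q) (hl : l ≠ 0) {c a : ℂ} {R : ℝ} {g : ℂ → ℂ}
    (hR : 0 < R) (hg : DifferentiableOn ℂ g (ball c R))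
    (h0 : (p = 1 ∧ q = 1) ∨ ∀ t ∈ ball c R, g t ≠ 0)
    (h1 : ∀ t ∈ ball c R, g t ≠ l * Complex.I ^ p)
    (h2 : ∀ t ∈ ball c R, g t ≠ l * (-Complex.I) ^ p)
    (ha : Complex.cos (a ^ q) ≠ 0) (hfa : f p q l a = g c) :
    ∃ h : ℂ → ℂ, DifferentiableOn ℂ h (ball c R) ∧ h c = a ∧
      ∀ t ∈ ball c R, Complex.cos (h t ^ q) ≠ 0 ∧ f p q l (h t) = g t := by
  have hc : c ∈ ball c R := mem_ball_self hR
  obtain ⟨u, hu, huc, hup⟩ := exists_root_on_ball (a := Complex.tan (a ^ q)) hp hR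
    (hg.div_const l) (h0.imp (fun h => h.1) fun h t ht => div_ne_zero (h t ht) hl)
    (by rw [← hfa, f, mul_div_cancel_left₀ _ hl])
  have hug : ∀ t ∈ ball c R, l * u t ^ p = g t := fun t ht => by
    rw [hup t ht, mul_div_cancel₀ _ hl]
  have hm : ∀ t ∈ ball c R, 1 - Complex.I * u t ≠ 0 := by
    intro t ht h
    apply h2 t ht
    rw [← hug t ht]
    congr 2
    linear_combination Complex.I * h + u t * Complex.I_sq
  have hpl : ∀ t ∈ ball c R, 1 + Complex.I * u t ≠ 0 := by
    intro t ht h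
    apply h1 t ht
    rw [← hug t ht]
    congr 2
    linear_combination -Complex.I * h + u t * Complex.I_sq
  -- The quotient is `exp (2iH)` for `tan H = u`, hence `H = L / (2i)` is a branch of `arctan u`,
  -- and the lift is a `q`-th root of it.
  obtain ⟨L, hL, hLc, hLe⟩ := exists_log_on_ball (a := 2 * Complex.I * a ^ q)
    (G := fun t => (1 + Complex.I * u t) / (1 - Complex.I * u t)) hR
    (((hu.const_mul Complex.I).const_add 1).div ((hu.const_mul Complex.I).const_sub 1) hm)
    (fun t ht => div_ne_zero (hpl t ht) (hm t ht))
    (by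
      have := hm c hc
      rw [huc] at this
      rw [huc, eq_div_iff this]
      exact exp_mul_of_tan ha)
  have h2I : (2 * Complex.I) ≠ 0 := mul_ne_zero two_ne_zero Complex.I_ne_zero
  have htan : ∀ t ∈ ball c R, Complex.cos (L t / (2 * Complex.I)) ≠ 0 ∧
      Complex.tan (L t / (2 * Complex.I)) = u t := fun t ht => by
    apply tan_eq_of_exp
    rw [mul_div_cancel₀ _ h2I, hLe t ht, div_mul_cancel₀ _ (hm t ht)]
  obtain ⟨h, hh, hhc, hhq⟩ := exists_root_on_ball (a := a) hq hR (hL.div_const (2 * Complex.I))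
    (h0.imp (fun h => h.2) fun h t ht h' => by
      have := (htan t ht).2
      rw [h', Complex.tan_zero] at this
      apply h t ht
      rw [← hug t ht, ← this, zero_pow (by lia), mul_zero])
    (by rw [hLc, mul_div_cancel_left₀ _ h2I])
  refine ⟨h, hh, hhc, fun t ht => ?_⟩
  rw [f, hhq t ht, (htan t ht).2]
  exact ⟨(htan t ht).1, hug t ht⟩

/-- The orbit of `0` is constant, so a cycle attracting it contains `0` and is therefore `{0}`. -/
theorem not_attractedTo_zero (hp : 1 ≤ p) (hq : 1 ≤ q) (h : IsAttractingPoint p q l n z)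
    (hz : z ≠ 0) : ¬ AttractedTo p q l 0 (orbit p q l z) := by
  intro ha
  have h1 : AttractedTo p q l 0 {0} := ⟨ha.1, by
    simp [iterate_f_zero hp hq]⟩
  obtain ⟨x, hx, hx0⟩ := ha.inter_nonempty h1 h.finite_orbit (Set.finite_singleton 0)
    orbit_nonempty (Set.singleton_nonempty 0)
  rw [mem_singleton_iff] at hx0
  subst hx0
  have h2 := orbit_eq_of_mem h.period_pos h.iterate_eq hx
  rw [orbit_of_fixed (f_zero hp hq)] at h2
  have : z ∈ ({0} : Set ℂ) := by rw [h2]; exact self_mem_orbit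
  exact hz this

/-- An attracting cycle whose basin is not dense attracts an asymptotic value. -/
theorem IsAttractingPoint.attractedTo_asymptotic_value (hp : 1 ≤ p) (hq : 1 ≤ q) (hl : l ≠ 0)
    (h : IsAttractingPoint p q l n z) (hz : (p = 1 ∧ q = 1) ∨ z ≠ 0) {b : ℂ} {ρ : ℝ} (hρ : 0 < ρ)
    (hb : ∀ w ∈ ball b ρ, ¬ AttractedTo p q l w (orbit p q l z)) :
    AttractedTo p q l (l * Complex.I ^ p) (orbit p q l z) ∨
      AttractedTo p q l (l * (-Complex.I) ^ p) (orbit p q l z) := by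
  by_contra! hcon
  obtain ⟨hv1, hv2⟩ := hcon
  obtain ⟨R, hR, hball⟩ := exists_ball_attractedTo h.period_pos h.orbit_defined h.iterate_eq
    h.multiplier_lt_one
  have hn := h.period_pos
  have hper : ∀ k, (f p q l)^[n * k] z = z := fun k => by
    rw [Function.iterate_mul]; exact Function.iterate_fixed h.iterate_eq k
  -- A branch of the inverse of the `k`-th iterate on a fixed disc. It follows the cycle backwards:
  -- `(n - 1) * k` steps forward are `k` steps back. Its values stay in the basin, hence avoid the
  -- asymptotic values, and `0` where needed, so it can be lifted again.
  have hbranch : ∀ k, ∃ g : ℂ → ℂ, DifferentiableOn ℂ g (ball z R) ∧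
      g z = (f p q l)^[(n - 1) * k] z ∧
      ∀ t ∈ ball z R, (f p q l)^[k] (g t) = t ∧ AttractedTo p q l (g t) (orbit p q l z) := by
    intro k
    induction k with
    | zero => exact ⟨id, differentiableOn_id, by simp, fun t ht => ⟨rfl, hball t ht⟩⟩
    | succ k ih =>
      obtain ⟨g, hg, hgz, hgt⟩ := ih
      obtain ⟨G, hG, hGz, hGt⟩ := exists_lift hp hq hl (a := (f p q l)^[(n - 1) * (k + 1)] z) hR hg
        (hz.imp_right fun hz t ht h0 =>
          not_attractedTo_zero hp hq h hz (h0 ▸ (hgt t ht).2))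
        (fun t ht h1 => hv1 (h1 ▸ (hgt t ht).2)) (fun t ht h1 => hv2 (h1 ▸ (hgt t ht).2))
        (h.orbit_defined _) (by
          rw [hgz, ← Function.iterate_succ_apply' (f p q l),
            (by rw [mul_add]; lia : ((n - 1) * (k + 1)).succ = (n - 1) * k + n),
            Function.iterate_add_apply, h.iterate_eq])
      refine ⟨G, hG, hGz, fun t ht => ⟨?_, ?_⟩⟩
      · rw [Function.iterate_succ_apply, (hGt t ht).2, (hgt t ht).1]
      · exact attractedTo_of_map (hGt t ht).1 ((hGt t ht).2 ▸ (hgt t ht).2)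
  set μ := deriv ((f p q l)^[n]) z with hμ
  have hμ0 : 0 < ‖μ‖ := norm_pos_iff.2 h.multiplier_ne_zero
  have hR2 : 0 < R / 2 := by positivity
  have hzR : z ∈ ball z R := mem_ball_self hR
  -- The branch for time `n * j` fixes `z` with derivative `μ⁻¹ ^ j` and omits the disc about `b`.
  -- So `1 / (g - b)` is bounded by `1 / ρ`, and Cauchy's estimate bounds the derivative
  -- independently of `j`.
  have hbound : ∀ j : ℕ, (‖μ‖⁻¹) ^ j ≤ ‖z - b‖ ^ 2 * (ρ⁻¹ / (R / 2)) := by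
    intro j
    obtain ⟨g, hg, hgz, hgt⟩ := hbranch (n * j)
    have hgz' : g z = z := by
      rw [hgz, (by ring : (n - 1) * (n * j) = n * ((n - 1) * j)), hper]
    have hgb : ∀ t ∈ ball z R, ρ ≤ ‖g t - b‖ := by
      intro t ht
      by_contra! hlt
      exact hb (g t) (by rwa [mem_ball, dist_eq_norm]) (hgt t ht).2
    have hgb0 : ∀ t ∈ ball z R, g t - b ≠ 0 := fun t ht =>
      norm_pos_iff.1 (hρ.trans_le (hgb t ht))
    have hgd := (hg.differentiableAt (isOpen_ball.mem_nhds hzR)).hasDerivAt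
    have hmul : μ ^ j * deriv g z = 1 := by
      have h1 : HasDerivAt ((f p q l)^[n])^[j] (μ ^ j) (g z) := by
        rw [hgz']
        exact HasDerivAt.iterate z (differentiableAt_iterate n fun i _ =>
          h.orbit_defined i).hasDerivAt h.iterate_eq j
      rw [← Function.iterate_mul] at h1
      have h2 := h1.comp z hgd
      refine h2.unique ((hasDerivAt_id z).congr_of_eventuallyEq ?_)
      filter_upwards [isOpen_ball.mem_nhds hzR] with t ht
      exact (hgt t ht).1
    have hinv : HasDerivAt (fun t => (g t - b)⁻¹) (-deriv g z / (z - b) ^ 2) z := by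
      have := (hgd.sub_const b).inv (hgb0 z hzR)
      rwa [hgz'] at this
    have hdc : DiffContOnCl ℂ (fun t => (g t - b)⁻¹) (ball z (R / 2)) := by
      apply DifferentiableOn.diffContOnCl
      refine DifferentiableOn.mono (t := ball z R) ?_ ?_
      · exact (hg.sub_const b).inv hgb0
      · exact closure_ball_subset_closedBall.trans (closedBall_subset_ball (by linarith))
    have hC := Complex.norm_deriv_le_of_forall_mem_sphere_norm_le (C := ρ⁻¹) hR2 hdc (by
      intro t ht
      rw [norm_inv]
      exact inv_anti₀ hρ (hgb t (closedBall_subset_ball (by linarith) (sphere_subset_closedBall ht))))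
    rw [hinv.deriv, norm_div, norm_neg, norm_pow] at hC
    have hzb : 0 < ‖z - b‖ ^ 2 := by
      have := hgb z hzR
      rw [hgz'] at this
      have := hρ.trans_le this
      positivity
    rw [div_le_iff₀ hzb] at hC
    have hmn : ‖μ‖ ^ j * ‖deriv g z‖ = 1 := by
      rw [← norm_pow, ← norm_mul, hmul, norm_one]
    have : (‖μ‖⁻¹) ^ j = ‖deriv g z‖ := by
      rw [inv_pow]; exact inv_eq_of_mul_eq_one_right hmn
    rw [this]
    linarith
  obtain ⟨j, hj⟩ := pow_unbounded_of_one_lt (‖z - b‖ ^ 2 * (ρ⁻¹ / (R / 2)))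
    ((one_lt_inv₀ hμ0).2 h.multiplier_lt_one)
  exact absurd (hbound j) (not_le.2 hj)

end TanFamily

/-! ### Geometry of the attracting region and properness of the value map. -/

namespace TanFamily

open Metric Set

variable {p q : ℕ} {W W' : ℂ}

theorem norm_sinh_sq (W : ℂ) : ‖Complex.sinh W‖ ^ 2 = Real.sinh W.re ^ 2 + Real.sin W.im ^ 2 := by
  have h : Complex.sinh W = (Real.sinh W.re * Real.cos W.im : ℝ)
      + (Real.cosh W.re * Real.sin W.im : ℝ) * Complex.I := by
    conv_lhs => rw [← Complex.re_add_im W]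
    rw [Complex.sinh_add, Complex.sinh_mul_I, Complex.cosh_mul_I]
    push_cast
    ring
  rw [h, Complex.sq_norm, Complex.normSq_add_mul_I]
  have h1 := Real.cosh_sq W.re
  have h2 := Real.sin_sq_add_cos_sq W.im
  linear_combination Real.sin W.im ^ 2 * h1 + Real.sinh W.re ^ 2 * h2

theorem norm_cosh_sq (W : ℂ) : ‖Complex.cosh W‖ ^ 2 = Real.sinh W.re ^ 2 + Real.cos W.im ^ 2 := by
  have h : Complex.cosh W = (Real.cosh W.re * Real.cos W.im : ℝ)
      + (Real.sinh W.re * Real.sin W.im : ℝ) * Complex.I := by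
    conv_lhs => rw [← Complex.re_add_im W]
    rw [Complex.cosh_add, Complex.sinh_mul_I, Complex.cosh_mul_I]
    push_cast
    ring
  rw [h, Complex.sq_norm, Complex.normSq_add_mul_I]
  have h1 := Real.cosh_sq W.re
  have h2 := Real.sin_sq_add_cos_sq W.im
  linear_combination Real.cos W.im ^ 2 * h1 + Real.sinh W.re ^ 2 * h2

/-- The quotient `sinh t / t` increases: with `s = y / x ≥ 1`, the function `sinh (s t) - s sinh t`
vanishes at `0` and has derivative `s (cosh (s t) - cosh t) ≥ 0`. -/
theorem sinh_mul_le_sinh_mul {x y : ℝ} (hx : 0 < x) (hxy : x ≤ y) :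
    Real.sinh x * y ≤ Real.sinh y * x := by
  set s := y / x with hs
  have hs1 : 1 ≤ s := (one_le_div hx).2 hxy
  have hy : y = s * x := by rw [hs]; field_simp
  have hmono : MonotoneOn (fun t => Real.sinh (s * t) - s * Real.sinh t) (Ici 0) := by
    have hd : ∀ t : ℝ, HasDerivAt (fun t => Real.sinh (s * t) - s * Real.sinh t)
        (Real.cosh (s * t) * s - s * Real.cosh t) t := fun t =>
      ((((hasDerivAt_id t).const_mul s).sinh).sub ((Real.hasDerivAt_sinh t).const_mul s)).congr_deriv
        (by simp)
    apply monotoneOn_of_deriv_nonneg (convex_Ici 0)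
      (fun t _ => (hd t).continuousAt.continuousWithinAt)
      (fun t _ => (hd t).differentiableAt.differentiableWithinAt)
    intro t ht
    rw [interior_Ici, mem_Ioi] at ht
    rw [(hd t).deriv]
    have : Real.cosh t ≤ Real.cosh (s * t) := by
      rw [Real.cosh_le_cosh, abs_of_pos ht, abs_of_pos (by positivity)]
      nlinarith
    nlinarith
  have h := hmono (mem_Ici.2 le_rfl) (mem_Ici.2 hx.le) hx.le
  simp only [mul_zero, Real.sinh_zero, sub_zero] at h
  rw [hy]
  nlinarith

/-- The values of `z ^ q`, rotated to the right half-plane, at the fixed points `z` of `f` whose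
multiplier has modulus less than one. -/
def attractingRegion (p q : ℕ) : Set ℂ :=
  {W | 0 < W.re ∧ 2 * (p * q) * ‖W‖ < ‖Complex.sinh (2 * W)‖}

/-- The asymptotic value, up to rotation, as a function of the fixed point. -/
noncomputable def valueMap (p q : ℕ) (W : ℂ) : ℂ := W ^ ((q : ℂ)⁻¹) / Complex.tanh W ^ p

/-- The parameters, up to rotation, that have a given type of attracting behaviour. -/
def parameterRegion (p q : ℕ) : Set ℂ := valueMap p q '' attractingRegion p q

theorem mem_attractingRegion_iff : W ∈ attractingRegion p q ↔ 0 < W.re ∧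
    (2 * (p * q)) ^ 2 * (W.re ^ 2 + W.im ^ 2)
      < Real.sinh (2 * W.re) ^ 2 + Real.sin (2 * W.im) ^ 2 := by
  have h1 : W.re ^ 2 + W.im ^ 2 = ‖W‖ ^ 2 := by rw [Complex.sq_norm, Complex.normSq_apply]; ring
  have h2 : Real.sinh (2 * W.re) ^ 2 + Real.sin (2 * W.im) ^ 2 = ‖Complex.sinh (2 * W)‖ ^ 2 := by
    rw [norm_sinh_sq]; simp
  rw [h1, h2, ← mul_pow, attractingRegion, mem_ofPred_eq,
    sq_lt_sq₀ (by positivity) (norm_nonneg _)]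

theorem isOpen_attractingRegion : IsOpen (attractingRegion p q) := by
  apply (isOpen_lt continuous_const Complex.continuous_re).inter
  have h1 : Continuous fun W : ℂ => 2 * (p * q : ℝ) * ‖W‖ := by fun_prop
  have h2 : Continuous fun W : ℂ => ‖Complex.sinh (2 * W)‖ := by fun_prop
  exact isOpen_lt h1 h2

/-- With `N = 2pq` the condition reads `sinh² 2x - N²x² > N²y² - sin² 2y`. The right side is
nonnegative since `N ≥ 2`, so the left side `x² ((sinh 2x / x)² - N²)` is positive, and then both of
its factors grow with `x`. -/
theorem mem_attractingRegion_of_re_le (hp : 1 ≤ p) (hq : 1 ≤ q) (h : W ∈ attractingRegion p q)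
    (hre : W.re ≤ W'.re)
    (him : W'.im = W.im) : W' ∈ attractingRegion p q := by
  rw [mem_attractingRegion_iff] at h ⊢
  obtain ⟨h0, h⟩ := h
  refine ⟨h0.trans_le hre, ?_⟩
  rw [him]
  set x := W.re
  set x' := W'.re
  set y := W.im
  set N : ℝ := 2 * (p * q) with hN
  have hs := sinh_mul_le_sinh_mul (mul_pos two_pos h0) (mul_le_mul_of_nonneg_left hre two_pos.le)
  have hS : 0 < Real.sinh (2 * x) := Real.sinh_pos_iff.2 (by positivity)
  have hy : Real.sin (2 * y) ^ 2 ≤ N ^ 2 * y ^ 2 := by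
    have h1 : Real.sin (2 * y) ^ 2 ≤ (2 * y) ^ 2 := Real.sin_sq_le_sq
    have h3 : (1 : ℝ) ≤ p * q := by exact_mod_cast Nat.mul_pos hp hq
    have h4 : (2 : ℝ) ^ 2 ≤ N ^ 2 := by
      apply pow_le_pow_left₀ two_pos.le; rw [hN]; linarith
    nlinarith [sq_nonneg y]
  have h5 : 0 < Real.sinh (2 * x) ^ 2 - N ^ 2 * x ^ 2 := by nlinarith
  have h6 : (Real.sinh (2 * x) ^ 2 - N ^ 2 * x ^ 2) * x' ^ 2
      ≤ (Real.sinh (2 * x') ^ 2 - N ^ 2 * x' ^ 2) * x ^ 2 := by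
    have : (Real.sinh (2 * x) * x') ^ 2 ≤ (Real.sinh (2 * x') * x) ^ 2 := by
      apply pow_le_pow_left₀ (mul_nonneg hS.le (h0.le.trans hre))
      linarith
    nlinarith
  have h7 : Real.sinh (2 * x) ^ 2 - N ^ 2 * x ^ 2 ≤ Real.sinh (2 * x') ^ 2 - N ^ 2 * x' ^ 2 := by
    have h8 : x ^ 2 ≤ x' ^ 2 := pow_le_pow_left₀ h0.le hre 2
    have h9 : 0 < x ^ 2 := by positivity
    refine le_of_mul_le_mul_right ?_ h9
    nlinarith
  nlinarith

/-- Here `sinh 2x ≥ x²`, and `x⁴` exceeds `4(pq)² · 2x²` because `x² > 8(pq)²`. -/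
theorem mem_attractingRegion_of_large (h : 3 * (p * q : ℝ) + 1 ≤ W.re) (hW : |W.im| ≤ W.re) :
    W ∈ attractingRegion p q := by
  rw [mem_attractingRegion_iff]
  have hN : (0 : ℝ) ≤ p * q := by positivity
  have h0 : 0 < W.re := by linarith
  refine ⟨h0, ?_⟩
  have h1 : W.re ^ 2 ≤ Real.sinh (2 * W.re) := by
    rw [Real.sinh_eq]
    have h2 := Real.quadratic_le_exp_of_nonneg (x := 2 * W.re) (by positivity)
    have h3 : Real.exp (-(2 * W.re)) ≤ 1 := Real.exp_le_one_iff.2 (by linarith)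
    nlinarith
  have h2 : (W.re ^ 2) ^ 2 ≤ Real.sinh (2 * W.re) ^ 2 := pow_le_pow_left₀ (by positivity) h1 2
  have h3 : W.im ^ 2 ≤ W.re ^ 2 := by
    rw [← sq_abs W.im]; exact pow_le_pow_left₀ (abs_nonneg _) hW 2
  have h4 : 8 * (p * q : ℝ) ^ 2 < W.re ^ 2 := by nlinarith
  have h5 : 0 < W.re ^ 2 := by positivity
  nlinarith [sq_nonneg (Real.sin (2 * W.im)), sq_nonneg (p * q : ℝ)]

theorem isConnected_attractingRegion (hp : 1 ≤ p) (hq : 1 ≤ q) :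
    IsConnected (attractingRegion p q) := by
  apply IsPathConnected.isConnected
  have hne : ((3 * (p * q : ℝ) + 1 : ℝ) : ℂ) ∈ attractingRegion p q := by
    apply mem_attractingRegion_of_large
    · simp
    · simp only [Complex.ofReal_im, abs_zero, Complex.ofReal_re]; positivity
  refine isPathConnected_iff.2 ⟨⟨_, hne⟩, fun a ha b hb => ?_⟩
  -- Both points move horizontally to the line `Re = X`, which is so far right that the vertical
  -- segment between them lies in the region.
  set X := max (3 * (p * q : ℝ) + 1) (max (max a.re b.re) (max |a.im| |b.im|)) with hX
  have hXa : a.re ≤ X := le_max_of_le_right (le_max_of_le_left (le_max_left _ _))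
  have hXb : b.re ≤ X := le_max_of_le_right (le_max_of_le_left (le_max_right _ _))
  have hYa : |a.im| ≤ X := le_max_of_le_right (le_max_of_le_right (le_max_left _ _))
  have hYb : |b.im| ≤ X := le_max_of_le_right (le_max_of_le_right (le_max_right _ _))
  have horiz : ∀ c ∈ attractingRegion p q, c.re ≤ X →
      JoinedIn (attractingRegion p q) c (⟨X, c.im⟩ : ℂ) := by
    intro c hc hcX
    apply JoinedIn.of_segment_subset
    rintro w ⟨s, t, hs, ht, hst, rfl⟩
    apply mem_attractingRegion_of_re_le hp hq hc
    · simp only [Complex.add_re, Complex.real_smul, Complex.mul_re, Complex.ofReal_re,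
        Complex.ofReal_im, zero_mul, sub_zero]
      have h1 : c.re = s * c.re + t * c.re := by rw [← add_mul, hst, one_mul]
      have h2 := mul_le_mul_of_nonneg_left hcX ht
      linarith
    · simp only [Complex.add_im, Complex.real_smul, Complex.mul_im, Complex.ofReal_re,
        Complex.ofReal_im, zero_mul, add_zero]
      rw [← add_mul, hst, one_mul]
  refine (horiz a ha hXa).trans (JoinedIn.trans ?_ (horiz b hb hXb).symm)
  apply JoinedIn.of_segment_subset
  rintro w ⟨s, t, hs, ht, hst, rfl⟩
  apply mem_attractingRegion_of_large
  · simp only [Complex.add_re, Complex.real_smul, Complex.mul_re, Complex.ofReal_re,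
        Complex.ofReal_im, zero_mul, sub_zero]
    rw [← add_mul, hst, one_mul]
    exact le_max_left _ _
  · simp only [Complex.add_re, Complex.real_smul, Complex.mul_re, Complex.ofReal_re,
        Complex.ofReal_im, zero_mul, sub_zero, Complex.add_im, Complex.mul_im, add_zero]
    rw [← add_mul, hst, one_mul]
    refine (abs_add_le _ _).trans ?_
    rw [abs_mul, abs_mul, abs_of_nonneg hs, abs_of_nonneg ht]
    have h1 : X = s * X + t * X := by rw [← add_mul, hst, one_mul]
    have h2 := mul_le_mul_of_nonneg_left hYa hs
    have h3 := mul_le_mul_of_nonneg_left hYb ht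
    linarith

theorem sinh_two_mul_ne_zero (h : W ∈ attractingRegion p q) : Complex.sinh (2 * W) ≠ 0 :=
  norm_pos_iff.1 (lt_of_le_of_lt (by positivity) h.2)

theorem sinh_ne_zero_of_two_mul (h : Complex.sinh (2 * W) ≠ 0) : Complex.sinh W ≠ 0 := by
  rw [Complex.sinh_two_mul] at h
  exact right_ne_zero_of_mul (left_ne_zero_of_mul h)

theorem cosh_ne_zero_of_two_mul (h : Complex.sinh (2 * W) ≠ 0) : Complex.cosh W ≠ 0 := by
  rw [Complex.sinh_two_mul] at h
  exact right_ne_zero_of_mul h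

theorem tanh_ne_zero_of_two_mul (h : Complex.sinh (2 * W) ≠ 0) : Complex.tanh W ≠ 0 := by
  rw [Complex.tanh_eq_sinh_div_cosh]
  exact div_ne_zero (sinh_ne_zero_of_two_mul h) (cosh_ne_zero_of_two_mul h)

theorem ne_zero_of_re_pos (h : 0 < W.re) : W ≠ 0 := by
  rintro rfl
  simp at h

theorem differentiableAt_valueMap (h0 : 0 < W.re) (h : Complex.sinh (2 * W) ≠ 0) :
    DifferentiableAt ℂ (valueMap p q) W := by
  have ht : DifferentiableAt ℂ Complex.tanh W := by
    have : Complex.tanh = fun W => Complex.sinh W / Complex.cosh W := by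
      ext; exact Complex.tanh_eq_sinh_div_cosh _
    rw [this]
    exact Complex.differentiable_sinh.differentiableAt.div
      Complex.differentiable_cosh.differentiableAt (cosh_ne_zero_of_two_mul h)
  exact (differentiableAt_id.cpow_const (Or.inl h0)).div (ht.pow p)
    (pow_ne_zero _ (tanh_ne_zero_of_two_mul h))

theorem differentiableOn_valueMap : DifferentiableOn ℂ (valueMap p q) (attractingRegion p q) :=
  fun _ h =>
    (differentiableAt_valueMap h.1 (sinh_two_mul_ne_zero h)).differentiableWithinAt

/-- As `|sinh W| |cosh W| ≥ 1` and `|sinh W|² ≤ |cosh W|² + 1`, the denominator `cosh W` cannot be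
small. -/
theorem norm_tanh_le_two (h : 2 ≤ ‖Complex.sinh (2 * W)‖) : ‖Complex.tanh W‖ ≤ 2 := by
  have h0 : Complex.sinh (2 * W) ≠ 0 := norm_pos_iff.1 (by linarith)
  have hc := norm_pos_iff.2 (cosh_ne_zero_of_two_mul h0)
  rw [Complex.tanh_eq_sinh_div_cosh, norm_div, div_le_iff₀ hc]
  rw [Complex.sinh_two_mul, norm_mul, norm_mul, Complex.norm_ofNat] at h
  have h1 := norm_sinh_sq W
  have h2 := norm_cosh_sq W
  have h3 : ‖Complex.sinh W‖ ^ 2 ≤ ‖Complex.cosh W‖ ^ 2 + 1 := by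
    nlinarith [Real.sin_sq_le_one W.im, sq_nonneg (Real.cos W.im)]
  by_contra! hlt
  have h4 : 3 * ‖Complex.cosh W‖ ^ 2 < 1 := by nlinarith
  have h5 : 1 ≤ ‖Complex.sinh W‖ * ‖Complex.cosh W‖ := by linarith
  nlinarith [sq_nonneg (‖Complex.sinh W‖ - 2 * ‖Complex.cosh W‖)]

/-- For `|W| > 1` in the region, `|sinh 2W| > 2`, so `tanh` is bounded by `2` and `|W|^{1/q} ≤ 2^p
B`. This gives both the unboundedness of the image and the compactness behind `exists_limit_point`.
-/
theorem norm_le_of_norm_valueMap_le (hp : 1 ≤ p) (hq : 1 ≤ q) (h : W ∈ attractingRegion p q)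
    {B : ℝ} (hB : ‖valueMap p q W‖ ≤ B) : ‖W‖ ≤ max 1 ((2 ^ p * B) ^ q) := by
  by_contra! hlt
  obtain ⟨h1, h2⟩ := max_lt_iff.1 hlt
  have hpq : (1 : ℝ) ≤ p * q := by exact_mod_cast Nat.mul_pos hp hq
  have ht : ‖Complex.tanh W‖ ≤ 2 := norm_tanh_le_two (by nlinarith [h.2])
  have ht0 := norm_pos_iff.2 (tanh_ne_zero_of_two_mul (sinh_two_mul_ne_zero h))
  have hroot : ‖W ^ ((q : ℂ)⁻¹)‖ ≤ 2 ^ p * B := by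
    have h3 : W ^ ((q : ℂ)⁻¹) = Complex.tanh W ^ p * valueMap p q W := by
      rw [valueMap, mul_div_cancel₀ _ (pow_ne_zero _ (norm_pos_iff.1 ht0))]
    rw [h3, norm_mul, norm_pow]
    gcongr
  have h4 : ‖W‖ = ‖W ^ ((q : ℂ)⁻¹)‖ ^ q := by
    rw [← norm_pow, Complex.cpow_nat_inv_pow _ (by lia)]
  rw [h4] at h2
  exact absurd h2 (not_lt.2 (pow_le_pow_left₀ (norm_nonneg _) hroot q))

theorem exists_mem_attractingRegion_norm (hp : 1 ≤ p) (hq : 1 ≤ q) (B : ℝ) :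
    ∃ W ∈ attractingRegion p q, B < ‖valueMap p q W‖ := by
  set X := max (3 * (p * q : ℝ) + 1) (max 1 ((2 ^ p * B) ^ q) + 1) with hX
  have hX0 : 0 ≤ X := le_trans (by positivity) (le_max_left _ _)
  have h : (X : ℂ) ∈ attractingRegion p q := by
    apply mem_attractingRegion_of_large
    · simp [hX]
    · simpa using hX0
  refine ⟨X, h, ?_⟩
  by_contra! hle
  have h1 := norm_le_of_norm_valueMap_le hp hq h hle
  rw [Complex.norm_of_nonneg hX0] at h1
  have h2 : max 1 ((2 ^ p * B) ^ q) + 1 ≤ X := le_max_right _ _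
  linarith

theorem isOpen_parameterRegion (hp : 1 ≤ p) (hq : 1 ≤ q) : IsOpen (parameterRegion p q) := by
  rcases (differentiableOn_valueMap.analyticOnNhd
    isOpen_attractingRegion).is_constant_or_isOpen (isConnected_attractingRegion hp hq).isPreconnected
    with ⟨w, hw⟩ | h
  · exfalso
    obtain ⟨W, hW, hlt⟩ := exists_mem_attractingRegion_norm hp hq ‖w‖
    rw [hw W hW] at hlt
    exact lt_irrefl _ hlt
  · exact h _ subset_rfl isOpen_attractingRegion

theorem isConnected_parameterRegion (hp : 1 ≤ p) (hq : 1 ≤ q) :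
    IsConnected (parameterRegion p q) :=
  (isConnected_attractingRegion hp hq).image _ differentiableOn_valueMap.continuousOn

theorem not_isBounded_parameterRegion (hp : 1 ≤ p) (hq : 1 ≤ q) :
    ¬ Bornology.IsBounded (parameterRegion p q) := by
  intro h
  obtain ⟨B, hB⟩ := h.exists_norm_le
  obtain ⟨W, hW, hlt⟩ := exists_mem_attractingRegion_norm hp hq B
  exact absurd (hB _ ⟨W, hW, rfl⟩) (not_le.2 hlt)

theorem conj_mem_attractingRegion (h : W ∈ attractingRegion p q) :
    (starRingEnd ℂ) W ∈ attractingRegion p q := by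
  rw [mem_attractingRegion_iff] at h ⊢
  simpa using h

theorem conj_root (h : 0 < W.re) :
    ((starRingEnd ℂ) W) ^ ((q : ℂ)⁻¹) = (starRingEnd ℂ) (W ^ ((q : ℂ)⁻¹)) := by
  rw [Complex.conj_cpow, map_inv₀, Complex.conj_natCast]
  intro hpi
  rw [Complex.arg_eq_pi_iff] at hpi
  linarith [hpi.1]

theorem valueMap_conj (h : 0 < W.re) :
    valueMap p q ((starRingEnd ℂ) W) = (starRingEnd ℂ) (valueMap p q W) := by
  rw [valueMap, valueMap, conj_root h, Complex.tanh_conj, map_div₀, map_pow]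

theorem conj_mem_parameterRegion {k : ℂ} (h : k ∈ parameterRegion p q) :
    (starRingEnd ℂ) k ∈ parameterRegion p q := by
  obtain ⟨W, hW, rfl⟩ := h
  exact ⟨_, conj_mem_attractingRegion hW, valueMap_conj hW.1⟩

theorem exists_pos_mem_parameterRegion (hq : 1 ≤ q) :
    ∃ t : ℝ, 0 < t ∧ (t : ℂ) ∈ parameterRegion p q := by
  set X := 3 * (p * q : ℝ) + 1
  have hX : 0 < X := by positivity
  refine ⟨X ^ ((q : ℝ)⁻¹) / Real.tanh X ^ p, ?_, X, ?_, ?_⟩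
  · have : 0 < Real.tanh X := by
      rw [Real.tanh_eq_sinh_div_cosh]
      exact div_pos (Real.sinh_pos_iff.2 hX) (Real.cosh_pos X)
    positivity
  · apply mem_attractingRegion_of_large
    · simp [X]
    · simpa using hX.le
  · rw [valueMap]
    push_cast
    rw [Complex.ofReal_cpow hX.le]
    push_cast
    rfl

/-- Limits on the imaginary axis away from `0` are impossible since `|sin 2y| < 2|y|`. A limit at
`0` forces `pq = 1` since `sinh 2W ~ 2W`, and then `W / tanh W → 1`. -/
theorem exists_limit_point (hp : 1 ≤ p) (hq : 1 ≤ q) {u : ℕ → ℂ} {k : ℂ}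
    (hu : ∀ m, u m ∈ attractingRegion p q)
    (hk : Tendsto (fun m => valueMap p q (u m)) atTop (𝓝 k)) :
    ∃ W, ∃ φ : ℕ → ℕ, StrictMono φ ∧ Tendsto (u ∘ φ) atTop (𝓝 W) ∧
      (0 < W.re ∧ 2 * (p * q) * ‖W‖ ≤ ‖Complex.sinh (2 * W)‖ ∧ valueMap p q W = k ∨
        W = 0 ∧ p = 1 ∧ q = 1 ∧ k = 1) := by
  obtain ⟨B, hB⟩ := (Metric.isBounded_range_of_tendsto _ hk).exists_norm_le
  have hb : Bornology.IsBounded (range u) := by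
    rw [isBounded_iff_forall_norm_le]
    refine ⟨max 1 ((2 ^ p * B) ^ q), ?_⟩
    rintro _ ⟨m, rfl⟩
    exact norm_le_of_norm_valueMap_le hp hq (hu m) (hB _ ⟨m, rfl⟩)
  obtain ⟨W, -, φ, hφ, hlim⟩ := tendsto_subseq_of_bounded hb fun m => mem_range_self m
  have hpq : (1 : ℝ) ≤ p * q := by exact_mod_cast Nat.mul_pos hp hq
  have hre : 0 ≤ W.re := ge_of_tendsto' ((Complex.continuous_re.tendsto W).comp hlim)
    fun m => (hu (φ m)).1.le
  have hle : 2 * (p * q) * ‖W‖ ≤ ‖Complex.sinh (2 * W)‖ := by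
    have h1 : Continuous fun W : ℂ => 2 * (p * q) * ‖W‖ := by fun_prop
    have h2 : Continuous fun W : ℂ => ‖Complex.sinh (2 * W)‖ := by fun_prop
    exact le_of_tendsto_of_tendsto' ((h1.tendsto W).comp hlim) ((h2.tendsto W).comp hlim)
      fun m => (hu (φ m)).2.le
  have hk' := hk.comp hφ.tendsto_atTop
  refine ⟨W, φ, hφ, hlim, ?_⟩
  by_cases hW : W = 0
  · right
    subst hW
    have hs : HasDerivAt Complex.sinh 1 0 := by simpa using Complex.hasDerivAt_sinh 0
    have hpq1 : p * q = 1 := by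
      by_contra hne
      have h2 : (2 : ℝ) ≤ p * q := by
        have : 1 ≤ p * q := Nat.mul_pos hp hq
        exact_mod_cast (by lia : 2 ≤ p * q)
      have h3 := (hasDerivAt_iff_isLittleO.1 hs).bound (c := 1 / 2) (by norm_num)
      have h4 : Tendsto (fun m => 2 * u (φ m)) atTop (𝓝 0) := by
        simpa using hlim.const_mul 2
      obtain ⟨m, hm⟩ := (h4.eventually h3).exists
      simp only [sub_zero, Complex.sinh_zero, smul_eq_mul, mul_one] at hm
      have h5 := (hu (φ m)).2
      have h6 := norm_sub_norm_le (Complex.sinh (2 * u (φ m))) (2 * u (φ m))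
      rw [norm_mul 2 (u (φ m)), Complex.norm_ofNat] at h6 hm
      have h7 : 0 < ‖u (φ m)‖ := norm_pos_iff.2 (ne_zero_of_re_pos (hu (φ m)).1)
      nlinarith
    obtain ⟨rfl, rfl⟩ := mul_eq_one.1 hpq1
    refine ⟨rfl, rfl, rfl, tendsto_nhds_unique hk' ?_⟩
    have hne : Tendsto (u ∘ φ) atTop (𝓝[≠] 0) :=
      tendsto_nhdsWithin_iff.2 ⟨hlim, Eventually.of_forall fun m =>
        ne_zero_of_re_pos (hu (φ m)).1⟩
    have h1 := (hasDerivAt_iff_tendsto_slope.1 hs).comp hne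
    have h2 := ((Complex.continuous_cosh.tendsto 0).comp hlim).div h1 one_ne_zero
    simp only [Complex.cosh_zero, div_one] at h2
    refine h2.congr fun m => ?_
    have h3 := sinh_ne_zero_of_two_mul (sinh_two_mul_ne_zero (hu (φ m)))
    have h4 := cosh_ne_zero_of_two_mul (sinh_two_mul_ne_zero (hu (φ m)))
    have h5 := ne_zero_of_re_pos (hu (φ m)).1
    simp only [Pi.div_apply, Function.comp_apply, slope_def_field, Complex.sinh_zero, sub_zero,
      valueMap, Nat.cast_one, inv_one, Complex.cpow_one, pow_one, Complex.tanh_eq_sinh_div_cosh]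
    field_simp
  · left
    have hWn : 0 < ‖W‖ := norm_pos_iff.2 hW
    have hsinh : Complex.sinh (2 * W) ≠ 0 :=
      norm_pos_iff.1 (lt_of_lt_of_le (by positivity) hle)
    have hre' : 0 < W.re := by
      refine lt_of_le_of_ne hre fun h0 => ?_
      have h1 : (2 * (p * q) * ‖W‖) ^ 2 ≤ ‖Complex.sinh (2 * W)‖ ^ 2 :=
        pow_le_pow_left₀ (by positivity) hle 2
      have h2 : ‖W‖ ^ 2 = W.im ^ 2 := by
        rw [Complex.sq_norm, Complex.normSq_apply, ← h0]; ring
      rw [norm_sinh_sq, mul_pow, h2] at h1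
      simp only [Complex.mul_re, Complex.re_ofNat, Complex.im_ofNat, zero_mul, sub_zero,
        Complex.mul_im, add_zero, ← h0, mul_zero, Real.sinh_zero] at h1
      have him : W.im ≠ 0 := by
        intro h
        rw [h] at h2
        have : ‖W‖ ^ 2 = 0 := by rw [h2]; ring
        exact hWn.ne' (pow_eq_zero_iff two_ne_zero |>.1 this)
      have h3 : Real.sin (2 * W.im) ^ 2 < (2 * W.im) ^ 2 :=
        Real.sin_sq_lt_sq (mul_ne_zero two_ne_zero him)
      have h4 : (2 : ℝ) ^ 2 ≤ (2 * (p * q)) ^ 2 :=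
        pow_le_pow_left₀ two_pos.le (by linarith) 2
      nlinarith [sq_nonneg W.im]
    exact ⟨hre', hle, tendsto_nhds_unique
      ((differentiableAt_valueMap hre' hsinh).continuousAt.tendsto.comp hlim) hk'⟩

end TanFamily

/-! ### Symmetries of `f`, the fate of the free value, and uniqueness of attracting cycles. -/

namespace TanFamily

open Metric Set

variable {p q n k : ℕ} {l z w : ℂ} {C : Set ℂ}

theorem hasDerivAt_f (hc : Complex.cos (z ^ q) ≠ 0) :
    HasDerivAt (f p q l) (l * (p * Complex.tan (z ^ q) ^ (p - 1) *
      (1 / Complex.cos (z ^ q) ^ 2 * (q * z ^ (q - 1))))) z := by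
  have h1 : HasDerivAt (fun w => Complex.tan (w ^ q))
      (1 / Complex.cos (z ^ q) ^ 2 * (q * z ^ (q - 1))) z :=
    (Complex.hasDerivAt_tan hc).comp z (hasDerivAt_pow q z)
  exact (h1.pow p).const_mul l

/-- The logarithmic derivative `z f' / f = 2pq z^q / sin (2 z^q)`, cleared of denominators. -/
theorem mul_deriv_f (hp : 1 ≤ p) (hq : 1 ≤ q) (hc : Complex.cos (z ^ q) ≠ 0) :
    z * deriv (f p q l) z * Complex.sin (2 * z ^ q) = 2 * (p * q) * z ^ q * f p q l z := by
  rw [(hasDerivAt_f hc).deriv, f, Complex.sin_two_mul]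
  obtain ⟨p, rfl⟩ := Nat.exists_eq_add_of_le' hp
  obtain ⟨q, rfl⟩ := Nat.exists_eq_add_of_le' hq
  simp only [Nat.add_sub_cancel]
  have h : Complex.sin (z ^ (q + 1))
      = Complex.tan (z ^ (q + 1)) * Complex.cos (z ^ (q + 1)) :=
    (Complex.tan_mul_cos hc).symm
  rw [h]
  generalize Complex.tan (z ^ (q + 1)) = T
  generalize Complex.cos (z ^ (q + 1)) = c at hc
  field_simp
  ring

theorem f_neg (z : ℂ) : f p q l (-z) = (-1) ^ (p * q) * f p q l z := by
  rcases Nat.even_or_odd q with hq | hq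
  · rw [f, hq.neg_pow, (hq.mul_left p).neg_one_pow, one_mul, f]
  · rw [f, hq.neg_pow, Complex.tan_neg, neg_pow, mul_comm p q, pow_mul, hq.neg_one_pow, f]
    ring

theorem cos_neg_pow (z : ℂ) : Complex.cos ((-z) ^ q) = Complex.cos (z ^ q) := by
  rcases Nat.even_or_odd q with hq | hq
  · rw [hq.neg_pow]
  · rw [hq.neg_pow, Complex.cos_neg]

theorem f_neg_of_odd (h : Odd (p * q)) (z : ℂ) : f p q l (-z) = -f p q l z := by
  rw [f_neg, h.neg_one_pow, neg_one_mul]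

theorem f_neg_of_even (h : Even (p * q)) (z : ℂ) : f p q l (-z) = f p q l z := by
  rw [f_neg, h.neg_one_pow, one_mul]

theorem f_neg_param : f p q (-l) z = -f p q l z := by rw [f, f, neg_mul]

theorem deriv_f_neg (z : ℂ) : deriv (f p q l) (-z) = -(-1) ^ (p * q) * deriv (f p q l) z := by
  have h1 := deriv_comp_neg (f p q l) z
  have h2 : (fun x => f p q l (-x)) = fun x => (-1) ^ (p * q) * f p q l x := funext f_neg
  rw [h2, deriv_const_mul_field] at h1
  linear_combination h1

theorem norm_deriv_f_neg (z : ℂ) : ‖deriv (f p q l) (-z)‖ = ‖deriv (f p q l) z‖ := by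
  rw [deriv_f_neg, norm_mul, norm_neg, norm_pow, norm_neg, norm_one, one_pow, one_mul]

theorem deriv_f_neg_param : deriv (f p q (-l)) z = -deriv (f p q l) z := by
  have : f p q (-l) = fun z => -f p q l z := funext fun z => f_neg_param
  rw [this, deriv.fun_neg]

theorem iterate_f_neg (h : Odd (p * q)) (m : ℕ) (z : ℂ) :
    (f p q l)^[m] (-z) = -(f p q l)^[m] z :=
  ((show Function.Semiconj Neg.neg (f p q l) (f p q l) from
    fun z => (f_neg_of_odd h z).symm).iterate_right m z).symm

theorem iterate_f_neg_param (h : Odd (p * q)) (m : ℕ) (z : ℂ) :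
    (f p q (-l))^[m] z = (f p q l)^[m] z ∨ (f p q (-l))^[m] z = -(f p q l)^[m] z := by
  induction m with
  | zero => exact Or.inl rfl
  | succ m ih =>
    rw [Function.iterate_succ_apply', Function.iterate_succ_apply', f_neg_param]
    rcases ih with ih | ih
    · right; rw [ih]
    · left; rw [ih, f_neg_of_odd h, neg_neg]

theorem AttractedTo.neg (h : Odd (p * q)) (hw : AttractedTo p q l w C) :
    AttractedTo p q l (-w) (Neg.neg '' C) := by
  refine ⟨fun m => ?_, ?_⟩
  · rw [iterate_f_neg h, cos_neg_pow]; exact hw.1 m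
  · refine hw.2.congr fun m => ?_
    rw [iterate_f_neg h, infDist_image (Φ := Neg.neg) (IsometryEquiv.neg ℂ).isometry]

theorem AttractedTo.neg_singleton (h : Odd (p * q)) (hw : AttractedTo p q l w {z}) :
    AttractedTo p q l (-w) {-z} := by
  simpa using hw.neg h

theorem AttractedTo.neg_pair (h : Odd (p * q)) (hw : AttractedTo p q l w {z, -z}) :
    AttractedTo p q l (-w) {z, -z} := by
  have := hw.neg h
  rwa [image_pair, neg_neg, pair_comm] at this

theorem infDist_neg_pair (x z : ℂ) : infDist (-x) {z, -z} = infDist x {z, -z} := by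
  have : ({z, -z} : Set ℂ) = Neg.neg '' ({z, -z} : Set ℂ) := by
    rw [image_pair, neg_neg, pair_comm]
  conv_lhs => rw [this]
  exact infDist_image (Φ := Neg.neg) (IsometryEquiv.neg ℂ).isometry

theorem AttractedTo.of_neg_param (h : Odd (p * q)) (hw : AttractedTo p q (-l) w {z, -z}) :
    AttractedTo p q l w {z, -z} := by
  refine ⟨fun m => ?_, hw.2.congr fun m => ?_⟩
  · have := hw.1 m
    rcases iterate_f_neg_param (l := l) h m w with h1 | h1
    · rwa [h1] at this
    · rwa [h1, cos_neg_pow] at this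
  · rcases iterate_f_neg_param (l := l) h m w with h1 | h1
    · rw [h1]
    · rw [h1, infDist_neg_pair]

theorem orbitDefined_of_fixed (hc : Complex.cos (z ^ q) ≠ 0) (hz : f p q l z = z) :
    OrbitDefined p q l z := fun m => by rwa [Function.iterate_fixed hz]

theorem isAttractingPoint_one_iff : IsAttractingPoint p q l 1 z ↔ Complex.cos (z ^ q) ≠ 0 ∧
    f p q l z = z ∧ deriv (f p q l) z ≠ 0 ∧ ‖deriv (f p q l) z‖ < 1 := by
  constructor
  · intro h
    refine ⟨h.orbit_defined 0, h.iterate_eq, ?_, ?_⟩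
    · simpa using h.multiplier_ne_zero
    · simpa using h.multiplier_lt_one
  · rintro ⟨hc, hz, h0, h1⟩
    exact ⟨one_pos, orbitDefined_of_fixed hc hz, Function.minimalPeriod_eq_one_iff_isFixedPt.2 hz,
      by simpa using h0, by simpa using h1⟩

namespace IsAttractingPoint

theorem fixed (h : IsAttractingPoint p q l 1 z) : f p q l z = z := h.iterate_eq

theorem orbit_one (h : IsAttractingPoint p q l 1 z) : orbit p q l z = {z} :=
  orbit_of_fixed h.fixed

theorem neg (hodd : Odd (p * q)) (h : IsAttractingPoint p q l 1 z) :
    IsAttractingPoint p q l 1 (-z) := by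
  rw [isAttractingPoint_one_iff] at h ⊢
  obtain ⟨hc, hz, h0, h1⟩ := h
  refine ⟨by rwa [cos_neg_pow], by rw [f_neg_of_odd hodd, hz], ?_, by rwa [norm_deriv_f_neg]⟩
  rw [← norm_ne_zero_iff, norm_deriv_f_neg]
  exact norm_ne_zero_iff.2 h0

end IsAttractingPoint

theorem deriv_f_zero (hp : 1 ≤ p) (hq : 1 ≤ q) (h : ¬(p = 1 ∧ q = 1)) :
    deriv (f p q l) 0 = 0 := by
  have hc : Complex.cos ((0 : ℂ) ^ q) ≠ 0 := by
    rw [zero_pow (by lia), Complex.cos_zero]; exact one_ne_zero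
  rw [(hasDerivAt_f hc).deriv]
  by_cases hq1 : q = 1
  · rw [zero_pow (by lia : q ≠ 0), Complex.tan_zero, zero_pow (by lia : p - 1 ≠ 0)]; ring
  · rw [zero_pow (by lia : q - 1 ≠ 0)]; ring

theorem IsAttractingPoint.ne_zero (hp : 1 ≤ p) (hq : 1 ≤ q) (h : IsAttractingPoint p q l n z) :
    (p = 1 ∧ q = 1) ∨ z ≠ 0 := by
  by_contra! hcon
  obtain ⟨h1, rfl⟩ := hcon
  have hn : n = 1 := by
    rw [← h.period_eq]
    exact Function.minimalPeriod_eq_one_iff_isFixedPt.2 (f_zero hp hq)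
  subst hn
  exact (isAttractingPoint_one_iff.1 h).2.2.1 (deriv_f_zero hp hq fun h => h1 h.1 h.2)

/-- By `mul_deriv_f` the only possible critical value is the fixed point `0`; for `p = q = 1` there
is none. -/
theorem not_attractedTo_of_mem_criticalValues (hp : 1 ≤ p) (hq : 1 ≤ q) (hl : l ≠ 0)
    (h : IsAttractingPoint p q l n z) (hw : w ∈ criticalValues p q l) :
    ¬ AttractedTo p q l w (orbit p q l z) := by
  obtain ⟨c, hc, hd, rfl⟩ := hw
  have hpq : ¬(p = 1 ∧ q = 1) := by
    rintro ⟨rfl, rfl⟩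
    rw [(hasDerivAt_f hc).deriv] at hd
    simp [hl] at hd
    simp [hd] at hc
  have hz : z ≠ 0 := (h.ne_zero hp hq).resolve_left hpq
  have h0 : f p q l c = 0 := by
    have h1 := mul_deriv_f (l := l) hp hq hc
    rw [hd, mul_zero, zero_mul] at h1
    by_cases hc0 : c = 0
    · rw [hc0, f_zero hp hq]
    · have hp0 : (p : ℂ) ≠ 0 := by exact_mod_cast (by lia : p ≠ 0)
      have hq0 : (q : ℂ) ≠ 0 := by exact_mod_cast (by lia : q ≠ 0)
      simpa [hp0, hq0, hc0] using h1
  rw [h0]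
  exact not_attractedTo_zero hp hq h hz

/-- By the parity of `f`, the two asymptotic values can be replaced by `±v`, and by `v` alone
if `pq` is even. -/
theorem IsAttractingPoint.attractedTo_freeValue_of_ball (hp : 1 ≤ p) (hq : 1 ≤ q) (hl : l ≠ 0)
    (h : IsAttractingPoint p q l n z) {b : ℂ} {ρ : ℝ} (hρ : 0 < ρ)
    (hb : ∀ w ∈ ball b ρ, ¬ AttractedTo p q l w (orbit p q l z)) :
    AttractedTo p q l (freeValue p l) (orbit p q l z) ∨
      Odd (p * q) ∧ AttractedTo p q l (-freeValue p l) (orbit p q l z) := by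
  rcases h.attractedTo_asymptotic_value hp hq hl (h.ne_zero hp hq) hρ hb with h1 | h1
  · left; rwa [freeValue, mul_comm]
  · rcases Nat.even_or_odd p with hpe | hpo
    · left; rwa [freeValue, mul_comm, ← hpe.neg_pow]
    · rw [hpo.neg_pow, mul_neg, mul_comm, ← freeValue] at h1
      rcases Nat.even_or_odd q with hqe | hqo
      -- For `q` even, `v` and `-v` have the same image.
      · left
        apply attractedTo_of_map
        · rw [← cos_neg_pow]; exact h1.1 0
        · rw [← f_neg_of_even (hqe.mul_left p)]; exact h1.iterate 1
      · exact Or.inr ⟨hpo.mul hqo, h1⟩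

/-- The missing disc is found in the basin of the other cycle. -/
theorem IsAttractingPoint.attractedTo_freeValue_of_orbit_ne (hp : 1 ≤ p) (hq : 1 ≤ q)
    (hl : l ≠ 0) (h : IsAttractingPoint p q l n z) (h' : IsAttractingPoint p q l k w)
    (hne : orbit p q l z ≠ orbit p q l w) :
    AttractedTo p q l (freeValue p l) (orbit p q l z) ∨
      Odd (p * q) ∧ AttractedTo p q l (-freeValue p l) (orbit p q l z) := by
  obtain ⟨R, hR, hball⟩ := exists_ball_attractedTo h'.period_pos h'.orbit_defined h'.iterate_eq
    h'.multiplier_lt_one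
  exact h.attractedTo_freeValue_of_ball hp hq hl hR fun x hx hx' =>
    hne (h.orbit_eq h' hx' (hball x hx))

theorem ne_neg_self (hz : z ≠ 0) : z ≠ -z := fun h => hz (self_eq_neg.1 h)

/-- The missing disc lies in the basin of the superattracting point `0`, or in the basin of `-z`
when `p = q = 1`, where `0` need not attract. -/
theorem IsAttractingPoint.attractedTo_freeValue (hp : 1 ≤ p) (hq : 1 ≤ q) (hl : l ≠ 0)
    (h : IsAttractingPoint p q l 1 z) (hz : z ≠ 0) :
    AttractedTo p q l (freeValue p l) {z} ∨
      Odd (p * q) ∧ AttractedTo p q l (-freeValue p l) {z} := by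
  rw [← h.orbit_one]
  by_cases hpq : p = 1 ∧ q = 1
  · have h' := h.neg (by rw [hpq.1, hpq.2]; exact odd_one)
    refine h.attractedTo_freeValue_of_orbit_ne hp hq hl h' ?_
    rw [h.orbit_one, h'.orbit_one]
    exact fun h => ne_neg_self hz (singleton_injective h)
  · have hc : Complex.cos ((0 : ℂ) ^ q) ≠ 0 := by
      rw [zero_pow (by lia), Complex.cos_zero]; exact one_ne_zero
    obtain ⟨R, hR, hball⟩ := exists_ball_attractedTo (l := l) one_pos
      (orbitDefined_of_fixed hc (f_zero hp hq)) (f_zero hp hq)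
      (by rw [Function.iterate_one, deriv_f_zero hp hq hpq]; simp)
    refine h.attractedTo_freeValue_of_ball hp hq hl (b := 0) hR fun x hx hx' => ?_
    have hx0 := hball x hx
    rw [orbit_of_fixed (f_zero hp hq)] at hx0
    rw [h.orbit_one] at hx'
    obtain ⟨y, hy, hy'⟩ := hx'.inter_nonempty hx0 (finite_singleton _) (finite_singleton _)
      (singleton_nonempty _) (singleton_nonempty _)
    rw [mem_singleton_iff] at hy hy'
    exact hz (hy.symm.trans hy')

theorem IsAttractingPoint.attractedTo_freeValue_of_even (hp : 1 ≤ p) (hq : 1 ≤ q) (hl : l ≠ 0)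
    (heven : Even (p * q)) (h : IsAttractingPoint p q l 1 z) (hz : z ≠ 0) :
    AttractedTo p q l (freeValue p l) {z} :=
  (h.attractedTo_freeValue hp hq hl hz).resolve_right fun h' =>
    (Nat.not_odd_iff_even.2 heven) h'.1

theorem IsAttractingPoint.attractedTo_freeValue_of_odd (hp : 1 ≤ p) (hq : 1 ≤ q) (hl : l ≠ 0)
    (hodd : Odd (p * q)) (h : IsAttractingPoint p q l 1 z) (hz : z ≠ 0) :
    AttractedTo p q l (freeValue p l) {z} ∨ AttractedTo p q l (freeValue p l) {-z} := by
  rcases h.attractedTo_freeValue hp hq hl hz with h1 | ⟨-, h1⟩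
  · exact Or.inl h1
  · right; simpa using h1.neg_singleton hodd

theorem IsAttractingPoint.attractedTo_freeValue_pair (hp : 1 ≤ p) (hq : 1 ≤ q) (hl : l ≠ 0)
    (h : IsAttractingPoint p q l 1 z) (hz : z ≠ 0) :
    AttractedTo p q l (freeValue p l) {z, -z} := by
  rcases Nat.even_or_odd (p * q) with he | ho
  · exact (h.attractedTo_freeValue_of_even hp hq hl he hz).mono (singleton_nonempty _) (by simp)
  · rcases h.attractedTo_freeValue_of_odd hp hq hl ho hz with h1 | h1
    · exact h1.mono (singleton_nonempty _) (by simp)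
    · exact h1.mono (singleton_nonempty _) (by simp)

theorem eq_of_attractedTo_singleton (hz : AttractedTo p q l w {z}) {z' : ℂ}
    (hz' : AttractedTo p q l w {z'}) : z = z' := by
  obtain ⟨y, hy, hy'⟩ := hz.inter_nonempty hz' (finite_singleton _) (finite_singleton _)
      (singleton_nonempty _) (singleton_nonempty _)
  exact (mem_singleton_iff.1 hy).symm.trans hy'

theorem setOf_isAttractingPoint_of_even (hp : 1 ≤ p) (hq : 1 ≤ q) (hl : l ≠ 0)
    (heven : Even (p * q)) (h : IsAttractingPoint p q l 1 z) (hz : z ≠ 0) :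
    {w | IsAttractingPoint p q l 1 w} = {z} := by
  ext w
  refine ⟨fun hw => ?_, fun hw => by rw [mem_singleton_iff.1 hw]; exact h⟩
  have hw0 : w ≠ 0 := (IsAttractingPoint.ne_zero hp hq hw).resolve_left (by
    rintro ⟨rfl, rfl⟩
    exact absurd heven (by decide))
  exact eq_of_attractedTo_singleton
    (IsAttractingPoint.attractedTo_freeValue_of_even hp hq hl heven hw hw0)
    (h.attractedTo_freeValue_of_even hp hq hl heven hz)

theorem setOf_isAttractingPoint_of_odd (hp : 1 ≤ p) (hq : 1 ≤ q) (hl : l ≠ 0)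
    (hodd : Odd (p * q)) (h : IsAttractingPoint p q l 1 z) (hz : z ≠ 0) :
    {w | IsAttractingPoint p q l 1 w} = {z, -z} := by
  apply Subset.antisymm
  · intro w hw
    by_contra hne
    rw [mem_insert_iff, mem_singleton_iff, not_or] at hne
    have hw' : IsAttractingPoint p q l 1 w := hw
    have h1 := hw'.attractedTo_freeValue_of_orbit_ne hp hq hl h (by
      rw [hw'.orbit_one, h.orbit_one]
      exact fun h => hne.1 (singleton_injective h))
    rw [hw'.orbit_one] at h1
    have h2 : AttractedTo p q l (freeValue p l) {w} ∨ AttractedTo p q l (freeValue p l) {-w} := by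
      rcases h1 with h1 | ⟨-, h1⟩
      · exact Or.inl h1
      · right; simpa using h1.neg_singleton hodd
    rcases h2 with h2 | h2 <;>
      rcases h.attractedTo_freeValue_of_odd hp hq hl hodd hz with h3 | h3
    · exact hne.1 (eq_of_attractedTo_singleton h2 h3)
    · exact hne.2 (eq_of_attractedTo_singleton h2 h3)
    · exact hne.2 (by rw [← eq_of_attractedTo_singleton h2 h3, neg_neg])
    · exact hne.1 (neg_injective (eq_of_attractedTo_singleton h2 h3))
  · rintro w (rfl | rfl)
    · exact h
    · exact h.neg hodd

theorem orbit_of_map_eq_neg (hodd : Odd (p * q)) (h : f p q l z = -z) :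
    orbit p q l z = {z, -z} := by
  have h2 : (f p q l)^[2] z = z := by
    rw [Function.iterate_succ_apply, Function.iterate_one, h, f_neg_of_odd hodd, h, neg_neg]
  ext w
  rw [mem_orbit_iff two_pos h2]
  constructor
  · rintro ⟨j, hj, rfl⟩
    interval_cases j
    · simp
    · simp [h]
  · rintro (rfl | rfl)
    · exact ⟨0, two_pos, rfl⟩
    · exact ⟨1, one_lt_two, by simpa using h⟩

theorem map_eq_neg_of_neg_param (h : f p q (-l) z = z) : f p q l z = -z := by
  rw [f_neg_param] at h
  rw [← h, neg_neg, h]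

/-- Since `f_{-l} = -f_l` and `f_l` is odd, a fixed point of `f_{-l}` is exchanged with its negative
by `f_l`. This reduces the symmetric two-cycles to fixed points; the modulus of the multiplier is
squared. -/
theorem isAttractingPoint_two_of_neg_param (hodd : Odd (p * q)) (hz : z ≠ 0)
    (h : IsAttractingPoint p q (-l) 1 z) : IsAttractingPoint p q l 2 z := by
  obtain ⟨hc, hf, h0, h1⟩ := isAttractingPoint_one_iff.1 h
  have hf' := map_eq_neg_of_neg_param hf
  rw [deriv_f_neg_param, neg_ne_zero] at h0
  rw [deriv_f_neg_param, norm_neg] at h1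
  have h2 : (f p q l)^[2] z = z := by
    rw [Function.iterate_succ_apply, Function.iterate_one, hf', f_neg_of_odd hodd, hf', neg_neg]
  have hd : deriv (f p q l)^[2] z = deriv (f p q l) (-z) * deriv (f p q l) z := by
    have h3 := (hasDerivAt_f (p := p) (l := l) hc).differentiableAt.hasDerivAt
    have h4 : HasDerivAt (f p q l) (deriv (f p q l) (-z)) (f p q l z) := by
      rw [hf']
      exact (hasDerivAt_f (p := p) (l := l) (by rwa [cos_neg_pow])).differentiableAt.hasDerivAt
    exact (h4.comp z h3).deriv
  have hn : ‖deriv (f p q l)^[2] z‖ = ‖deriv (f p q l) z‖ * ‖deriv (f p q l) z‖ := by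
    rw [hd, norm_mul, norm_deriv_f_neg]
  have hpos := norm_pos_iff.2 h0
  refine ⟨two_pos, fun m => ?_, ?_, ?_, ?_⟩
  · have : (f p q l)^[m] z ∈ orbit p q l z := ⟨m, rfl⟩
    rw [orbit_of_map_eq_neg hodd hf'] at this
    rcases this with h | h
    · rwa [h]
    · rw [mem_singleton_iff.1 h, cos_neg_pow]; exact hc
  · have := Fact.mk Nat.prime_two
    refine Function.minimalPeriod_eq_prime_iff.2 ⟨h2, fun h => ?_⟩
    exact ne_neg_self hz (h.symm.trans hf')
  · rw [← norm_pos_iff, hn]; positivity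
  · rw [hn]; nlinarith

theorem freeValue_neg : freeValue p (-l) = -freeValue p l := by rw [freeValue, freeValue, mul_neg]

theorem attractedTo_pair_of_neg_param (hp : 1 ≤ p) (hq : 1 ≤ q) (hl : l ≠ 0)
    (hodd : Odd (p * q)) (h : IsAttractingPoint p q (-l) 1 z) (hz : z ≠ 0) :
    AttractedTo p q l (freeValue p l) {z, -z} := by
  have h1 := (h.attractedTo_freeValue_pair hp hq (neg_ne_zero.2 hl) hz).of_neg_param hodd
  rw [freeValue_neg] at h1
  simpa using h1.neg_pair hodd

/-- A second cycle would need `v` or `-v`, and the cycle `{z, -z}` attracts both. -/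
theorem setOf_isAttractingCycle_two (hp : 1 ≤ p) (hq : 1 ≤ q) (hl : l ≠ 0)
    (hodd : Odd (p * q)) (h : IsAttractingPoint p q (-l) 1 z) (hz : z ≠ 0) :
    {C | IsAttractingCycle p q l 2 C} = {{z, -z}} := by
  have h2 := isAttractingPoint_two_of_neg_param hodd hz h
  have ho := orbit_of_map_eq_neg hodd (map_eq_neg_of_neg_param h.fixed)
  have hv := attractedTo_pair_of_neg_param hp hq hl hodd h hz
  have hv' := hv.neg_pair hodd
  rw [← ho] at hv hv'
  apply Subset.antisymm
  · rintro _ ⟨w, hw, rfl⟩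
    rw [mem_singleton_iff, ← ho]
    change orbit p q l w = _
    by_contra hne
    rcases hw.attractedTo_freeValue_of_orbit_ne hp hq hl h2 hne with h3 | ⟨-, h3⟩
    · exact hne (hw.orbit_eq h2 h3 hv)
    · exact hne (hw.orbit_eq h2 h3 hv')
  · rintro _ rfl
    exact ⟨z, h2, ho.symm⟩

theorem mem_shellLocus (hp : 1 ≤ p) (hq : 1 ≤ q) (hl : l ≠ 0) (h : IsAttractingPoint p q l n z)
    (hv : AttractedTo p q l (freeValue p l) (orbit p q l z)) : l ∈ shellLocus p q :=
  ⟨hl, n, _, ⟨z, h, rfl⟩, hv, fun _ hw =>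
    not_attractedTo_of_mem_criticalValues hp hq hl h hw⟩

theorem IsAttractingPoint.mem_shellLocus (hp : 1 ≤ p) (hq : 1 ≤ q) (hl : l ≠ 0)
    (h : IsAttractingPoint p q l 1 z) (hz : z ≠ 0) : l ∈ shellLocus p q := by
  rcases Nat.even_or_odd (p * q) with he | ho
  · exact TanFamily.mem_shellLocus hp hq hl h
      (h.orbit_one ▸ h.attractedTo_freeValue_of_even hp hq hl he hz)
  · rcases h.attractedTo_freeValue_of_odd hp hq hl ho hz with h1 | h1
    · exact TanFamily.mem_shellLocus hp hq hl h (h.orbit_one ▸ h1)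
    · exact TanFamily.mem_shellLocus hp hq hl (h.neg ho) ((h.neg ho).orbit_one ▸ h1)

theorem mem_shellLocus_of_neg_param (hp : 1 ≤ p) (hq : 1 ≤ q) (hl : l ≠ 0)
    (hodd : Odd (p * q)) (h : IsAttractingPoint p q (-l) 1 z) (hz : z ≠ 0) :
    l ∈ shellLocus p q :=
  mem_shellLocus hp hq hl (isAttractingPoint_two_of_neg_param hodd hz h)
    (orbit_of_map_eq_neg hodd (map_eq_neg_of_neg_param h.fixed) ▸
      attractedTo_pair_of_neg_param hp hq hl hodd h hz)

/-- In the odd case, a symmetric cycle of period two gives a fixed point for the parameter `-l`;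
a single cycle of period two is symmetric. -/
theorem exists_isAttractingPoint_neg_param (hp : 1 ≤ p) (hq : 1 ≤ q) (hodd : Odd (p * q))
    (h : {C | IsAttractingCycle p q l 2 C}.ncard = 1) :
    ∃ z ≠ 0, IsAttractingPoint p q (-l) 1 z := by
  obtain ⟨C, hC⟩ := ncard_eq_one.1 h
  have hmem : IsAttractingCycle p q l 2 C := by
    have : C ∈ {C | IsAttractingCycle p q l 2 C} := by rw [hC]; rfl
    exact this
  obtain ⟨z, hz, rfl⟩ := hmem
  have h2 := hz.iterate_eq
  have hnf : f p q l z ≠ z := fun hf => by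
    have := hz.period_eq
    rw [Function.minimalPeriod_eq_one_iff_isFixedPt.2 hf] at this
    exact absurd this (by norm_num)
  have hz0 : z ≠ 0 := by
    rintro rfl
    exact hnf (f_zero hp hq)
  have hneg : IsAttractingPoint p q l 2 (-z) := by
    have hd : deriv (f p q l)^[2] (-z) = deriv (f p q l)^[2] z := by
      have h3 := deriv_comp_neg (f p q l)^[2] z
      have h4 : (fun x => (f p q l)^[2] (-x)) = fun x => -(f p q l)^[2] x :=
        funext fun w => iterate_f_neg hodd 2 w
      rw [h4, deriv.fun_neg] at h3
      exact neg_injective h3.symm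
    refine ⟨two_pos, fun m => ?_, ?_, hd ▸ hz.multiplier_ne_zero, hd ▸ hz.multiplier_lt_one⟩
    · rw [iterate_f_neg hodd, cos_neg_pow]; exact hz.orbit_defined m
    · have := Fact.mk Nat.prime_two
      refine Function.minimalPeriod_eq_prime_iff.2 ⟨?_, fun h => ?_⟩
      · change (f p q l)^[2] (-z) = -z
        rw [iterate_f_neg hodd, h2]
      · change f p q l (-z) = -z at h
        rw [f_neg_of_odd hodd] at h
        exact hnf (neg_injective h)
  -- Negation permutes the attracting two-cycles, so the only one is invariant and `f z = -z`.
  have horb : orbit p q l (-z) = orbit p q l z := by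
    have : orbit p q l (-z) ∈ {C | IsAttractingCycle p q l 2 C} := ⟨_, hneg, rfl⟩
    rw [hC] at this
    exact this
  have hmem : -z ∈ orbit p q l z := horb ▸ self_mem_orbit
  obtain ⟨j, hj, hjz⟩ := (mem_orbit_iff two_pos h2).1 hmem
  have hfz : f p q l z = -z := by
    interval_cases j
    · exact absurd hjz (ne_neg_self hz0)
    · simpa using hjz
  have hc : Complex.cos (z ^ q) ≠ 0 := hz.orbit_defined 0
  have hd : deriv (f p q l)^[2] z = deriv (f p q l) (-z) * deriv (f p q l) z := by
    have h3 := (hasDerivAt_f (p := p) (l := l) hc).differentiableAt.hasDerivAt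
    have h4 : HasDerivAt (f p q l) (deriv (f p q l) (-z)) (f p q l z) := by
      rw [hfz]
      exact (hasDerivAt_f (p := p) (l := l) (by rwa [cos_neg_pow])).differentiableAt.hasDerivAt
    exact (h4.comp z h3).deriv
  have hn : ‖deriv (f p q l)^[2] z‖ = ‖deriv (f p q l) z‖ ^ 2 := by
    rw [hd, norm_mul, norm_deriv_f_neg, sq]
  refine ⟨z, hz0, isAttractingPoint_one_iff.2 ⟨hc, ?_, ?_, ?_⟩⟩
  · rw [f_neg_param, hfz, neg_neg]
  · rw [deriv_f_neg_param, neg_ne_zero]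
    intro h
    exact hz.multiplier_ne_zero (by rw [hd, h, mul_zero])
  · rw [deriv_f_neg_param, norm_neg]
    have := hz.multiplier_lt_one
    rw [hn] at this
    by_contra! hge
    nlinarith

end TanFamily

/-! ### The explicit parametrization of the parameters with attracting fixed points. -/

namespace TanFamily

open Metric Set

variable {p q : ℕ} {l z e η W : ℂ}

theorem isAttractingPoint_one (hc : Complex.cos (z ^ q) ≠ 0) (hf : f p q l z = z)
    (h0 : 0 < ‖deriv (f p q l) z‖) (h1 : ‖deriv (f p q l) z‖ < 1) :
    IsAttractingPoint p q l 1 z :=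
  isAttractingPoint_one_iff.2 ⟨hc, hf, norm_pos_iff.1 h0, h1⟩

/-- The point `z` with `z ^ q = e * I * W`, in the sector around the ray through `η`. -/
noncomputable def sectorRoot (q : ℕ) (η W : ℂ) : ℂ := η * W ^ ((q : ℂ)⁻¹)

/-- The parameter for which `sectorRoot q η W` is fixed up to sign. -/
noncomputable def parameter (p q : ℕ) (η W : ℂ) : ℂ := (Complex.I ^ p)⁻¹ * η * valueMap p q W

/-- The shell component in the direction of `η`. -/
def shellRegion (p q : ℕ) (η : ℂ) : Set ℂ := parameter p q η '' attractingRegion p q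

theorem cos_rotate (he : e = 1 ∨ e = -1) (W : ℂ) :
    Complex.cos (e * Complex.I * W) = Complex.cosh W := by
  rcases he with rfl | rfl
  · rw [one_mul, mul_comm, Complex.cos_mul_I]
  · rw [neg_one_mul, neg_mul, Complex.cos_neg, mul_comm, Complex.cos_mul_I]

theorem sin_rotate (he : e = 1 ∨ e = -1) (W : ℂ) :
    Complex.sin (e * Complex.I * W) = e * Complex.I * Complex.sinh W := by
  rcases he with rfl | rfl
  · rw [one_mul, mul_comm, Complex.sin_mul_I, mul_comm]
  · rw [neg_one_mul, neg_mul, Complex.sin_neg, mul_comm, Complex.sin_mul_I]; ring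

theorem tan_rotate (he : e = 1 ∨ e = -1) (W : ℂ) :
    Complex.tan (e * Complex.I * W) = e * Complex.I * Complex.tanh W := by
  rw [Complex.tan_eq_sin_div_cos, sin_rotate he, cos_rotate he, Complex.tanh_eq_sinh_div_cosh,
    mul_div_assoc]

theorem norm_of_sign (he : e = 1 ∨ e = -1) : ‖e‖ = 1 := by
  rcases he with rfl | rfl <;> simp

theorem sign_sq (he : e = 1 ∨ e = -1) : e * e = 1 := by
  rcases he with rfl | rfl <;> ring

theorem pow_sign (he : e = 1 ∨ e = -1) (n : ℕ) : e ^ n = 1 ∨ e ^ n = -1 := by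
  rcases he with rfl | rfl
  · simp
  · exact neg_one_pow_eq_or ℂ n

theorem sign_pow_odd {n : ℕ} (he : e = 1 ∨ e = -1) (hn : Odd n) : e ^ n = e := by
  rcases he with rfl | rfl
  · simp
  · exact hn.neg_one_pow

theorem sign_pow_even {n : ℕ} (he : e = 1 ∨ e = -1) (hn : Even n) : e ^ n = 1 := by
  rcases he with rfl | rfl
  · simp
  · exact hn.neg_one_pow

theorem direction_ne_zero (hq : 1 ≤ q) (he : e = 1 ∨ e = -1) (hη : η ^ q = e * Complex.I) :
    η ≠ 0 := by
  rintro rfl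
  rw [zero_pow (by lia)] at hη
  have h : e * Complex.I ≠ 0 := by rcases he with rfl | rfl <;> simp
  exact h hη.symm

theorem norm_direction (hq : 1 ≤ q) (he : e = 1 ∨ e = -1) (hη : η ^ q = e * Complex.I) :
    ‖η‖ = 1 := by
  rw [← pow_eq_one_iff_of_nonneg (norm_nonneg _) (by lia : q ≠ 0), ← norm_pow, hη, norm_mul,
    norm_of_sign he, Complex.norm_I, one_mul]

theorem root_ne_zero (h0 : 0 < W.re) : W ^ ((q : ℂ)⁻¹) ≠ 0 := by
  rw [Ne, Complex.cpow_eq_zero_iff, not_and_or]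
  exact Or.inl (ne_zero_of_re_pos h0)

theorem root_re_pos (hq : 1 ≤ q) (h0 : 0 < W.re) : 0 < (W ^ ((q : ℂ)⁻¹)).re := by
  rw [Complex.cpow_def_of_ne_zero (ne_zero_of_re_pos h0), Complex.exp_re]
  apply mul_pos (Real.exp_pos _)
  have h1 : (Complex.log W * (q : ℂ)⁻¹).im = W.arg * (q : ℝ)⁻¹ := by
    rw [← Complex.ofReal_natCast, ← Complex.ofReal_inv, Complex.im_mul_ofReal, Complex.log_im]
  have h2 : |W.arg| < Real.pi / 2 := Complex.abs_arg_lt_pi_div_two_iff.2 (Or.inl h0)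
  have h3 : (q : ℝ)⁻¹ ≤ 1 := inv_le_one_of_one_le₀ (by exact_mod_cast hq)
  rw [h1]
  apply Real.cos_pos_of_mem_Ioo
  rw [mem_Ioo, ← abs_lt, abs_mul, abs_of_nonneg (by positivity : (0 : ℝ) ≤ (q : ℝ)⁻¹)]
  exact (mul_le_of_le_one_right (abs_nonneg _) h3).trans_lt h2

theorem sectorRoot_pow (hq : 1 ≤ q) (hη : η ^ q = e * Complex.I) :
    sectorRoot q η W ^ q = e * Complex.I * W := by
  rw [sectorRoot, mul_pow, hη, Complex.cpow_nat_inv_pow _ (by lia)]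

theorem sectorRoot_ne_zero (hq : 1 ≤ q) (he : e = 1 ∨ e = -1) (hη : η ^ q = e * Complex.I)
    (h0 : 0 < W.re) : sectorRoot q η W ≠ 0 :=
  mul_ne_zero (direction_ne_zero hq he hη) (root_ne_zero h0)

theorem parameter_ne_zero (hq : 1 ≤ q) (he : e = 1 ∨ e = -1) (hη : η ^ q = e * Complex.I)
    (h0 : 0 < W.re) (hs : Complex.sinh (2 * W) ≠ 0) : parameter p q η W ≠ 0 :=
  mul_ne_zero (mul_ne_zero (inv_ne_zero (pow_ne_zero _ Complex.I_ne_zero))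
    (direction_ne_zero hq he hη))
    (div_ne_zero (root_ne_zero h0) (pow_ne_zero _ (tanh_ne_zero_of_two_mul hs)))

theorem cos_sectorRoot_ne_zero (hq : 1 ≤ q) (he : e = 1 ∨ e = -1) (hη : η ^ q = e * Complex.I)
    (hs : Complex.sinh (2 * W) ≠ 0) : Complex.cos (sectorRoot q η W ^ q) ≠ 0 := by
  rw [sectorRoot_pow hq hη, cos_rotate he]
  exact cosh_ne_zero_of_two_mul hs

/-- The sign `e ^ p` governs the cases. For `pq` even it is absorbed, as `f` is even and fixes `e ^
p * z`. For `pq` odd, `e = -1` gives the two-cycle `{z, -z}`. -/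
theorem f_sectorRoot (hq : 1 ≤ q) (he : e = 1 ∨ e = -1) (hη : η ^ q = e * Complex.I)
    (hs : Complex.sinh (2 * W) ≠ 0) :
    f p q (parameter p q η W) (sectorRoot q η W) = e ^ p * sectorRoot q η W := by
  rw [f, sectorRoot_pow hq hη, tan_rotate he, parameter, valueMap, sectorRoot,
    mul_pow, mul_pow]
  have h1 := tanh_ne_zero_of_two_mul hs
  have h2 : Complex.I ^ p ≠ 0 := pow_ne_zero _ Complex.I_ne_zero
  field_simp

theorem norm_deriv_f_sectorRoot (hp : 1 ≤ p) (hq : 1 ≤ q) (he : e = 1 ∨ e = -1)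
    (hη : η ^ q = e * Complex.I) (h0 : 0 < W.re) (hs : Complex.sinh (2 * W) ≠ 0) :
    ‖deriv (f p q (parameter p q η W)) (sectorRoot q η W)‖ * ‖Complex.sinh (2 * W)‖
      = 2 * (p * q) * ‖W‖ := by
  have h1 := mul_deriv_f (l := parameter p q η W) hp hq (cos_sectorRoot_ne_zero hq he hη hs)
  rw [f_sectorRoot hq he hη hs, sectorRoot_pow hq hη,
    (by ring : 2 * (e * Complex.I * W) = e * Complex.I * (2 * W)), sin_rotate he] at h1
  have h2 := congrArg norm h1
  simp only [norm_mul, norm_pow, norm_of_sign he, Complex.norm_I, one_pow, one_mul,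
    Complex.norm_ofNat, Complex.norm_natCast] at h2
  have h3 : 0 < ‖sectorRoot q η W‖ := norm_pos_iff.2 (sectorRoot_ne_zero hq he hη h0)
  apply mul_left_cancel₀ h3.ne'
  linarith

section Region

variable (hp : 1 ≤ p) (hq : 1 ≤ q) (he : e = 1 ∨ e = -1) (hη : η ^ q = e * Complex.I)
  (hW : W ∈ attractingRegion p q)

include hp hq he hη hW

theorem deriv_f_sectorRoot_bounds :
    0 < ‖deriv (f p q (parameter p q η W)) (sectorRoot q η W)‖ ∧
      ‖deriv (f p q (parameter p q η W)) (sectorRoot q η W)‖ < 1 := by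
  have hs := sinh_two_mul_ne_zero hW
  have h1 := norm_deriv_f_sectorRoot hp hq he hη hW.1 hs
  have h2 := hW.2
  have h3 : 0 < ‖Complex.sinh (2 * W)‖ := norm_pos_iff.2 hs
  have h4 : 0 < ‖W‖ := norm_pos_iff.2 (ne_zero_of_re_pos hW.1)
  have h5 : (0 : ℝ) < p * q := by exact_mod_cast Nat.mul_pos hp hq
  constructor
  · refine lt_of_le_of_ne (norm_nonneg _) fun h => ?_
    rw [← h, zero_mul] at h1
    have : 0 < 2 * (p * q) * ‖W‖ := by positivity
    linarith
  · by_contra! hge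
    nlinarith

theorem isAttractingPoint_of_even (heven : Even (p * q)) :
    IsAttractingPoint p q (parameter p q η W) 1 (e ^ p * sectorRoot q η W) := by
  have hs := sinh_two_mul_ne_zero hW
  have hc := cos_sectorRoot_ne_zero hq he hη hs
  have hf := f_sectorRoot (p := p) hq he hη hs
  obtain ⟨h1, h2⟩ := deriv_f_sectorRoot_bounds hp hq he hη hW
  rcases pow_sign he p with h | h
  · rw [h, one_mul] at hf ⊢
    exact isAttractingPoint_one hc hf h1 h2
  · rw [h, neg_one_mul] at hf ⊢
    exact isAttractingPoint_one (by rwa [cos_neg_pow]) (by rw [f_neg_of_even heven, hf])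
      (by rwa [norm_deriv_f_neg]) (by rwa [norm_deriv_f_neg])

theorem isAttractingPoint_of_eq_one (h : e = 1) :
    IsAttractingPoint p q (parameter p q η W) 1 (sectorRoot q η W) := by
  have hs := sinh_two_mul_ne_zero hW
  have hf := f_sectorRoot (p := p) hq he hη hs
  obtain ⟨h1, h2⟩ := deriv_f_sectorRoot_bounds hp hq he hη hW
  rw [h, one_pow, one_mul] at hf
  exact isAttractingPoint_one (cos_sectorRoot_ne_zero hq he hη hs) hf h1 h2

theorem isAttractingPoint_of_eq_neg_one (hodd : Odd (p * q)) (h : e = -1) :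
    IsAttractingPoint p q (-parameter p q η W) 1 (sectorRoot q η W) := by
  have hs := sinh_two_mul_ne_zero hW
  have hf := f_sectorRoot (p := p) hq he hη hs
  obtain ⟨h1, h2⟩ := deriv_f_sectorRoot_bounds hp hq he hη hW
  rw [sign_pow_odd he (Nat.odd_mul.1 hodd).1, h, neg_one_mul] at hf
  exact isAttractingPoint_one (cos_sectorRoot_ne_zero hq he hη hs)
    (by rw [f_neg_param, hf, neg_neg]) (by rwa [deriv_f_neg_param, norm_neg])
    (by rwa [deriv_f_neg_param, norm_neg])

theorem parameter_mem_shellLocus : parameter p q η W ∈ shellLocus p q := by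
  have hl : parameter p q η W ≠ 0 :=
    parameter_ne_zero hq he hη hW.1 (sinh_two_mul_ne_zero hW)
  have hz := sectorRoot_ne_zero hq he hη hW.1
  rcases Nat.even_or_odd (p * q) with heven | hodd
  · refine (isAttractingPoint_of_even hp hq he hη hW heven).mem_shellLocus hp hq hl
      (mul_ne_zero (pow_ne_zero _ ?_) hz)
    rw [← norm_pos_iff, norm_of_sign he]
    exact one_pos
  · rcases id he with h | h
    · exact (isAttractingPoint_of_eq_one hp hq he hη hW h).mem_shellLocus hp hq hl hz
    · exact mem_shellLocus_of_neg_param hp hq hl hodd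
        (isAttractingPoint_of_eq_neg_one hp hq he hη hW hodd h) hz

theorem attractedTo_sectorRoot_pair : AttractedTo p q (parameter p q η W)
    (freeValue p (parameter p q η W)) {sectorRoot q η W, -sectorRoot q η W} := by
  have hl : parameter p q η W ≠ 0 :=
    parameter_ne_zero hq he hη hW.1 (sinh_two_mul_ne_zero hW)
  have hz := sectorRoot_ne_zero hq he hη hW.1
  rcases Nat.even_or_odd (p * q) with heven | hodd
  · have h := isAttractingPoint_of_even hp hq he hη hW heven
    rcases pow_sign he p with h1 | h1
    · rw [h1, one_mul] at h
      exact h.attractedTo_freeValue_pair hp hq hl hz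
    · rw [h1, neg_one_mul] at h
      have := h.attractedTo_freeValue_pair hp hq hl (neg_ne_zero.2 hz)
      rwa [neg_neg, pair_comm] at this
  · rcases id he with h | h
    · exact (isAttractingPoint_of_eq_one hp hq he hη hW h).attractedTo_freeValue_pair hp hq hl hz
    · exact attractedTo_pair_of_neg_param hp hq hl hodd
        (isAttractingPoint_of_eq_neg_one hp hq he hη hW hodd h) hz

theorem hasShellPeriod_parameter : HasShellPeriod p q 1 (parameter p q η W) := by
  have hl : parameter p q η W ≠ 0 :=
    parameter_ne_zero hq he hη hW.1 (sinh_two_mul_ne_zero hW)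
  have hz := sectorRoot_ne_zero hq he hη hW.1
  refine ⟨fun heven => ⟨_, _, isAttractingPoint_of_even hp hq he hη hW heven, rfl⟩, fun hodd => ?_⟩
  rcases id he with h | h
  · right
    have ha := isAttractingPoint_of_eq_one hp hq he hη hW h
    have hset := setOf_isAttractingPoint_of_odd hp hq hl hodd ha hz
    have : {C | IsAttractingCycle p q (parameter p q η W) 1 C}
        = {{sectorRoot q η W}, {-sectorRoot q η W}} := by
      apply Subset.antisymm
      · rintro _ ⟨w, hw, rfl⟩
        change orbit _ _ _ _ ∈ _
        rw [hw.orbit_one]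
        have : w ∈ {w | IsAttractingPoint p q (parameter p q η W) 1 w} := hw
        rw [hset] at this
        rcases this with rfl | h
        · exact Or.inl rfl
        · right; rw [mem_singleton_iff.1 h]; rfl
      · rintro _ (rfl | rfl)
        · exact ⟨_, ha, ha.orbit_one.symm⟩
        · exact ⟨_, ha.neg hodd, (ha.neg hodd).orbit_one.symm⟩
    rw [this]
    exact ncard_pair fun h => ne_neg_self hz (singleton_injective h)
  · left
    rw [mul_one, setOf_isAttractingCycle_two hp hq hl hodd
        (isAttractingPoint_of_eq_neg_one hp hq he hη hW hodd h) hz]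
    exact ncard_singleton _

end Region

/-- Inverts the parametrization. A real `z ^ q` is impossible because `|sin 2x| ≤ 2|x|`, so one
choice of sign puts `W` in the right half-plane. -/
theorem IsAttractingPoint.exists_mem_shellRegion (hp : 1 ≤ p) (hq : 1 ≤ q)
    (h : IsAttractingPoint p q l 1 z) (hz : z ≠ 0) :
    ∃ e η : ℂ, (e = 1 ∨ e = -1) ∧ η ^ q = e * Complex.I ∧ l ∈ shellRegion p q η ∧
      (Odd (p * q) → e = 1) := by
  obtain ⟨hc, hf, -, h1⟩ := isAttractingPoint_one_iff.1 h
  set Z := z ^ q with hZ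
  have hZ0 : Z ≠ 0 := pow_ne_zero _ hz
  have hpq : (1 : ℝ) ≤ p * q := by exact_mod_cast Nat.mul_pos hp hq
  have hm := mul_deriv_f (l := l) hp hq hc
  rw [hf, ← hZ] at hm
  have hlt : 2 * (p * q) * ‖Z‖ < ‖Complex.sin (2 * Z)‖ := by
    have h2 := congrArg norm hm
    simp only [norm_mul, Complex.norm_ofNat, Complex.norm_natCast] at h2
    have h3 : 0 < ‖z‖ := norm_pos_iff.2 hz
    have h4 : ‖deriv (f p q l) z‖ * ‖Complex.sin (2 * Z)‖ = 2 * (p * q) * ‖Z‖ := by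
      apply mul_left_cancel₀ h3.ne'; linarith
    have h5 : 0 < 2 * (p * q) * ‖Z‖ := by
      have := norm_pos_iff.2 hZ0
      positivity
    rw [← h4] at h5 ⊢
    have h6 : 0 < ‖Complex.sin (2 * Z)‖ := pos_of_mul_pos_right h5 (norm_nonneg _)
    nlinarith
  have key : ∀ e : ℂ, (e = 1 ∨ e = -1) → 0 < (-e * Complex.I * Z).re →
      ∃ e η : ℂ, (e = 1 ∨ e = -1) ∧ η ^ q = e * Complex.I ∧ l ∈ shellRegion p q η ∧
        (Odd (p * q) → e = 1) := by
    intro e he hre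
    set W := -e * Complex.I * Z with hWd
    have hee := sign_sq he
    have hZW : Z = e * Complex.I * W := by
      rw [hWd]; linear_combination Z * Complex.I ^ 2 * hee + Z * Complex.I_sq
    have hW : W ∈ attractingRegion p q := by
      refine ⟨hre, ?_⟩
      rw [hZW, (by ring : 2 * (e * Complex.I * W) = e * Complex.I * (2 * W)), sin_rotate he] at hlt
      simpa only [norm_mul, norm_of_sign he, Complex.norm_I, one_mul] using hlt
    have hr : W ^ ((q : ℂ)⁻¹) ≠ 0 := root_ne_zero hre
    have hepp : (e ^ p) * e ^ p = 1 := sign_sq (pow_sign he p)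
    -- The direction belongs to `e ^ p * z` rather than to `z`; its sign `e ^ (p * q + 1)` is `1`
    -- when `pq` is odd.
    have hη : (e ^ p * z / W ^ ((q : ℂ)⁻¹)) ^ q = e ^ (p * q + 1) * Complex.I := by
      rw [div_pow, Complex.cpow_nat_inv_pow _ (by lia), div_eq_iff (ne_zero_of_re_pos hre),
        mul_pow, ← hZ, hZW]
      ring
    refine ⟨e ^ (p * q + 1), _, pow_sign he _, hη, ⟨W, hW, ?_⟩,
      fun hodd => sign_pow_even he hodd.add_one⟩
    have ht := tanh_ne_zero_of_two_mul (sinh_two_mul_ne_zero hW)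
    have hI : Complex.I ^ p ≠ 0 := pow_ne_zero _ Complex.I_ne_zero
    rw [f, ← hZ, hZW, tan_rotate he] at hf
    rw [parameter, valueMap]
    rw [mul_pow, mul_pow] at hf
    generalize W ^ ((q : ℂ)⁻¹) = r at hr
    field_simp
    rw [← hf]
    linear_combination l * Complex.I ^ p * Complex.tanh W ^ p * hepp
  rcases lt_trichotomy Z.im 0 with him | him | him
  · exact key (-1) (Or.inr rfl) (by simpa using him)
  · exfalso
    have h2 : Complex.sin (2 * Z) = Complex.sin ((2 * Z.re : ℝ) : ℂ) := by
      congr 1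
      apply Complex.ext <;> simp [him]
    have h3 : ‖Z‖ = |Z.re| := by
      conv_lhs => rw [← Complex.re_add_im Z, him]
      simp
    rw [h2, ← Complex.ofReal_sin, Complex.norm_real, Real.norm_eq_abs, h3] at hlt
    have h4 : |Real.sin (2 * Z.re)| ≤ |2 * Z.re| := Real.abs_sin_le_abs
    rw [abs_mul, abs_two] at h4
    nlinarith [abs_nonneg Z.re]
  · exact key 1 (Or.inl rfl) (by simpa using him)

theorem shellRegion_neg (h : l ∈ shellRegion p q η) : -l ∈ shellRegion p q (-η) := by
  obtain ⟨W, hW, rfl⟩ := h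
  exact ⟨W, hW, by rw [parameter, parameter]; ring⟩

theorem HasShellPeriod.exists_mem_shellRegion (hp : 1 ≤ p) (hq : 1 ≤ q)
    (h : HasShellPeriod p q 1 l) :
    ∃ e η : ℂ, (e = 1 ∨ e = -1) ∧ η ^ q = e * Complex.I ∧ l ∈ shellRegion p q η := by
  rcases Nat.even_or_odd (p * q) with heven | hodd
  · obtain ⟨_, z, hz, rfl⟩ := h.1 heven
    have hz0 : z ≠ 0 := (hz.ne_zero hp hq).resolve_left (by
      rintro ⟨rfl, rfl⟩
      exact absurd heven (by decide))
    obtain ⟨e, η, he, hη, hmem, -⟩ := hz.exists_mem_shellRegion hp hq hz0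
    exact ⟨e, η, he, hη, hmem⟩
  · rcases h.2 hodd with h1 | h1
    · obtain ⟨z, hz0, hz⟩ := exists_isAttractingPoint_neg_param hp hq hodd h1
      obtain ⟨e, η, he, hη, hmem, he1⟩ := hz.exists_mem_shellRegion hp hq hz0
      refine ⟨-1, -η, Or.inr rfl, ?_, by simpa using shellRegion_neg hmem⟩
      rw [(Nat.odd_mul.1 hodd).2.neg_pow, hη, he1 hodd]
      ring
    · obtain ⟨C, D, hne, hCD⟩ := ncard_eq_two.1 h1
      have hC : C ∈ {C | IsAttractingCycle p q l 1 C} := by rw [hCD]; simp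
      have hD : D ∈ {C | IsAttractingCycle p q l 1 C} := by rw [hCD]; simp
      obtain ⟨z, hz, rfl⟩ := hC
      obtain ⟨w, hw, rfl⟩ := hD
      by_cases hz0 : z = 0
      · have hw0 : w ≠ 0 := by
          rintro rfl
          exact hne (by rw [hz0])
        obtain ⟨e, η, he, hη, hmem, -⟩ := hw.exists_mem_shellRegion hp hq hw0
        exact ⟨e, η, he, hη, hmem⟩
      · obtain ⟨e, η, he, hη, hmem, -⟩ := hz.exists_mem_shellRegion hp hq hz0
        exact ⟨e, η, he, hη, hmem⟩

end TanFamily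

/-! ### The regions are components of the shell locus, and they are disjoint. -/

namespace TanFamily

open Metric Set

variable {p q n : ℕ} {l z e η W : ℂ}

theorem norm_deriv_iterate_eq_one {E : Set ℂ} (hE : ∀ x ∈ E, f p q l x ∈ E)
    (hd : ∀ x ∈ E, ‖deriv (f p q l) x‖ = 1) (ho : OrbitDefined p q l z) (hz : z ∈ E) (m : ℕ) :
    ‖deriv ((f p q l)^[m]) z‖ = 1 := by
  have hmem : ∀ m, (f p q l)^[m] z ∈ E := fun m => by
    induction m with
    | zero => exact hz
    | succ m ih => rw [Function.iterate_succ_apply']; exact hE _ ih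
  induction m with
  | zero => simp
  | succ m ih =>
    have h1 := (differentiableAt_iterate m fun j _ => ho j).hasDerivAt
    have h2 := (hasDerivAt_f (p := p) (l := l) (ho m)).differentiableAt.hasDerivAt
    rw [Function.iterate_succ', (h2.comp z h1).deriv, norm_mul, ih, hd _ (hmem m), mul_one]

/-- For parameters near `l`, the free value returns close to `z` once in every `n` steps, yet its
orbit accumulates only on `±zs m`, which are close to `±x`. -/
theorem eq_or_eq_neg_of_tendsto {x : ℂ} {ls zs : ℕ → ℂ} (h : IsAttractingPoint p q l n z)
    (hv : AttractedTo p q l (freeValue p l) (orbit p q l z)) (hl : Tendsto ls atTop (𝓝 l))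
    (hz : Tendsto zs atTop (𝓝 x))
    (ha : ∀ m, AttractedTo p q (ls m) (freeValue p (ls m)) {zs m, -zs m}) :
    z = x ∨ z = -x := by
  by_contra! hne
  have h1 := norm_pos_iff.2 (sub_ne_zero.2 hne.1)
  have h2 := norm_pos_iff.2 (sub_ne_zero.2 hne.2)
  -- A third, for the three steps from `z` to the orbit, to `±zs m`, to `±x`.
  set r := min ‖z - x‖ ‖z - -x‖ / 3 with hr
  have hr0 : 0 < r := div_pos (lt_min h1 h2) three_pos
  have hr1 : 3 * r ≤ ‖z - x‖ := by rw [hr, mul_div_cancel₀ _ three_ne_zero]; exact min_le_left _ _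
  have hr2 : 3 * r ≤ ‖z - -x‖ := by
    rw [hr, mul_div_cancel₀ _ three_ne_zero]; exact min_le_right _ _
  have hcont : ContinuousAt (freeValue p) l := by
    unfold freeValue; fun_prop
  obtain ⟨m₀, hm₀⟩ := hv.eventually_near hcont h.period_pos h.orbit_defined h.iterate_eq
    h.multiplier_lt_one hr0
  obtain ⟨m, hm1, hm2⟩ := ((hl.eventually hm₀).and
    ((Metric.tendsto_nhds.1 hz) r hr0)).exists
  have htop : Tendsto (fun k => n * k + m₀) atTop atTop :=
    tendsto_atTop_mono (fun k =>
      (Nat.le_mul_of_pos_left k h.period_pos).trans (Nat.le_add_right _ _)) tendsto_id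
  obtain ⟨k, hk⟩ := (((ha m).2.comp htop).eventually (gt_mem_nhds hr0)).exists
  obtain ⟨y, hy, hyd⟩ := (infDist_lt_iff (insert_nonempty _ _)).1 hk
  have hk1 := hm1 k
  beta_reduce at hyd
  generalize (f p q (ls m))^[n * k + m₀] (freeValue p (ls m)) = w at hyd hk1
  rw [← dist_eq_norm] at hk1 hr1 hr2
  rcases hy with rfl | hy
  · have := dist_triangle4 z w (zs m) x
    rw [dist_comm z w] at this
    linarith
  · rw [mem_singleton_iff.1 hy] at hyd
    have := dist_triangle4 z w (-zs m) (-x)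
    rw [dist_comm z w, dist_neg_neg] at this
    linarith

theorem shellRegion_eq_image :
    shellRegion p q η = (fun k => (Complex.I ^ p)⁻¹ * η * k) '' parameterRegion p q := by
  rw [parameterRegion, image_image]
  rfl

theorem rotation_ne_zero (hη : η ≠ 0) : (Complex.I ^ p)⁻¹ * η ≠ 0 :=
  mul_ne_zero (inv_ne_zero (pow_ne_zero _ Complex.I_ne_zero)) hη

theorem isOpen_shellRegion (hp : 1 ≤ p) (hq : 1 ≤ q) (hη : η ≠ 0) :
    IsOpen (shellRegion p q η) := by
  rw [shellRegion_eq_image]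
  exact (Homeomorph.mulLeft₀ _ (rotation_ne_zero hη)).isOpenMap _ (isOpen_parameterRegion hp hq)

theorem isConnected_shellRegion (hp : 1 ≤ p) (hq : 1 ≤ q) :
    IsConnected (shellRegion p q η) := by
  rw [shellRegion_eq_image]
  exact (isConnected_parameterRegion hp hq).image _ (by fun_prop)

theorem not_isBounded_shellRegion (hp : 1 ≤ p) (hq : 1 ≤ q) (hη : η ≠ 0) :
    ¬ Bornology.IsBounded (shellRegion p q η) := by
  intro h
  apply not_isBounded_parameterRegion hp hq
  obtain ⟨B, hB⟩ := h.exists_norm_le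
  refine isBounded_iff_forall_norm_le.2 ⟨B / ‖(Complex.I ^ p)⁻¹ * η‖, fun k hk => ?_⟩
  rw [le_div_iff₀ (norm_pos_iff.2 (rotation_ne_zero hη)), mul_comm, ← norm_mul]
  exact hB _ (by rw [shellRegion_eq_image]; exact ⟨k, hk, rfl⟩)

theorem closure_shellRegion_inter_subset (hp : 1 ≤ p) (hq : 1 ≤ q) (he : e = 1 ∨ e = -1)
    (hη : η ^ q = e * Complex.I) :
    closure (shellRegion p q η) ∩ shellLocus p q ⊆ shellRegion p q η := by
  rintro l ⟨hcl, hl0, n, _, ⟨z, hz, rfl⟩, hv, -⟩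
  obtain ⟨ls, hls, hlim⟩ := mem_closure_iff_seq_limit.1 hcl
  choose u hu hul using hls
  have hη0 := direction_ne_zero hq he hη
  have hd := rotation_ne_zero (p := p) hη0
  have hk : Tendsto (fun m => valueMap p q (u m)) atTop (𝓝 (((Complex.I ^ p)⁻¹ * η)⁻¹ * l)) := by
    refine (hlim.const_mul (((Complex.I ^ p)⁻¹ * η)⁻¹)).congr fun m => ?_
    rw [← hul m, parameter, inv_mul_cancel_left₀ hd]
  obtain ⟨W, φ, hφ, hWlim, hW⟩ := exists_limit_point hp hq hu hk
  by_contra hnot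
  have hroot : Tendsto (fun m => sectorRoot q η (u (φ m))) atTop (𝓝 (sectorRoot q η W)) := by
    have hc : ContinuousAt (fun W : ℂ => W ^ ((q : ℂ)⁻¹)) W := by
      rcases hW with ⟨hre, -⟩ | ⟨-, -, rfl, -⟩
      · exact (differentiableAt_id.cpow_const (Or.inl hre)).continuousAt
      · simp only [Nat.cast_one, inv_one, Complex.cpow_one]
        exact continuousAt_id
    exact (hc.tendsto.comp hWlim).const_mul η
  have hpair := eq_or_eq_neg_of_tendsto hz hv (hlim.comp hφ.tendsto_atTop) hroot (fun m => by
    simp only [Function.comp_apply]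
    rw [← hul (φ m)]
    exact attractedTo_sectorRoot_pair hp hq he hη (hu (φ m)))
  have hneutral : ((f p q l (sectorRoot q η W) = sectorRoot q η W ∨
      f p q l (sectorRoot q η W) = -sectorRoot q η W)) ∧
      ‖deriv (f p q l) (sectorRoot q η W)‖ = 1 := by
    rcases hW with ⟨hre, hle, hval⟩ | ⟨rfl, rfl, rfl, hval⟩
    · have hl : parameter p q η W = l := by
        rw [parameter, hval, mul_inv_cancel_left₀ hd]
      have hpq : (1 : ℝ) ≤ p * q := by exact_mod_cast Nat.mul_pos hp hq
      have hWn : 0 < ‖W‖ := norm_pos_iff.2 (ne_zero_of_re_pos hre)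
      have hsn : 0 < ‖Complex.sinh (2 * W)‖ := lt_of_lt_of_le (by positivity) hle
      have hs := norm_pos_iff.1 hsn
      -- Strict inequality would put `l` in the region, so the limit point is neutral.
      have heq : 2 * (p * q) * ‖W‖ = ‖Complex.sinh (2 * W)‖ :=
        le_antisymm hle (not_lt.1 fun hlt => hnot ⟨W, ⟨hre, hlt⟩, hl⟩)
      have h1 := norm_deriv_f_sectorRoot hp hq he hη hre hs
      have h2 := f_sectorRoot (p := p) hq he hη hs
      rw [hl] at h1 h2
      rw [heq] at h1
      refine ⟨?_, by simpa [hsn.ne'] using h1⟩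
      rcases pow_sign he p with h | h
      · left; rw [h2, h, one_mul]
      · right; rw [h2, h, neg_one_mul]
    -- The degenerate limit for `λ tan z`: the cycles collapse to `0`, whose multiplier `l` has
    -- modulus one.
    · have h0 : sectorRoot 1 η 0 = 0 := by simp [sectorRoot]
      rw [h0]
      refine ⟨Or.inl (f_zero le_rfl le_rfl), ?_⟩
      have hc : Complex.cos ((0 : ℂ) ^ 1) ≠ 0 := by simp
      have hln : ‖l‖ = 1 := by
        rw [inv_mul_eq_one₀ hd] at hval
        rw [← hval, norm_mul, norm_inv, norm_pow, Complex.norm_I, one_pow, inv_one, one_mul,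
          norm_direction le_rfl he hη]
      rw [(hasDerivAt_f hc).deriv]
      simpa using hln
  obtain ⟨hf, hdn⟩ := hneutral
  have h1 : ‖deriv ((f p q l)^[n]) z‖ = 1 := by
    refine norm_deriv_iterate_eq_one (E := {sectorRoot q η W, -sectorRoot q η W}) ?_ ?_
      hz.orbit_defined (by rcases hpair with h | h <;> simp [h]) n
    · have h2 : f p q l (sectorRoot q η W) ∈
          ({sectorRoot q η W, -sectorRoot q η W} : Set ℂ) := by
        rcases hf with h | h <;> simp [h]
      rintro x (rfl | hx)
      · exact h2
      · rw [mem_singleton_iff.1 hx, f_neg]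
        rcases neg_one_pow_eq_or ℂ (p * q) with h | h <;> rcases hf with h' | h' <;> simp [h, h']
    · rintro x (rfl | hx)
      · exact hdn
      · rw [mem_singleton_iff.1 hx, norm_deriv_f_neg, hdn]
  exact absurd h1 hz.multiplier_lt_one.ne

theorem connectedComponentIn_shellLocus (hp : 1 ≤ p) (hq : 1 ≤ q) (he : e = 1 ∨ e = -1)
    (hη : η ^ q = e * Complex.I) (hl : l ∈ shellRegion p q η) :
    connectedComponentIn (shellLocus p q) l = shellRegion p q η := by
  have hsub : shellRegion p q η ⊆ shellLocus p q := by
    rintro _ ⟨W, hW, rfl⟩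
    exact parameter_mem_shellLocus hp hq he hη hW
  apply Subset.antisymm
  · apply isPreconnected_connectedComponentIn.subset_of_closure_inter_subset
      (isOpen_shellRegion hp hq (direction_ne_zero hq he hη))
    · exact ⟨l, mem_connectedComponentIn (hsub hl), hl⟩
    · exact fun x hx => closure_shellRegion_inter_subset hp hq he hη
        ⟨hx.1, connectedComponentIn_subset _ _ hx.2⟩
  · exact (isConnected_shellRegion hp hq).isPreconnected.subset_connectedComponentIn hl hsub

/-- The shell components of period one are the regions `shellRegion p q η`. -/
theorem mem_shellComponents_iff (hp : 1 ≤ p) (hq : 1 ≤ q) {Ω : Set ℂ} :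
    Ω ∈ shellComponents p q 1 ↔
      ∃ e η : ℂ, (e = 1 ∨ e = -1) ∧ η ^ q = e * Complex.I ∧ Ω = shellRegion p q η := by
  constructor
  · rintro ⟨⟨l, hl, rfl⟩, h⟩
    obtain ⟨e, η, he, hη, hmem⟩ :=
      (h l (mem_connectedComponentIn hl)).exists_mem_shellRegion hp hq
    exact ⟨e, η, he, hη, connectedComponentIn_shellLocus hp hq he hη hmem⟩
  · rintro ⟨e, η, he, hη, rfl⟩
    obtain ⟨l, hl⟩ := (isConnected_shellRegion (p := p) (η := η) hp hq).nonempty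
    refine ⟨⟨l, ?_, (connectedComponentIn_shellLocus hp hq he hη hl).symm⟩, ?_⟩
    · obtain ⟨W, hW, rfl⟩ := hl
      exact parameter_mem_shellLocus hp hq he hη hW
    · rintro _ ⟨W, hW, rfl⟩
      exact hasShellPeriod_parameter hp hq he hη hW

/-- The `q`-th powers give `e * W = e' * W'`; as both real parts are positive, the signs and then
the points `W` agree. -/
theorem eq_of_sectorRoot_eq (hq : 1 ≤ q) {e' η' W' : ℂ} (he : e = 1 ∨ e = -1)
    (hη : η ^ q = e * Complex.I) (hW : 0 < W.re) (he' : e' = 1 ∨ e' = -1)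
    (hη' : η' ^ q = e' * Complex.I) (hW' : 0 < W'.re)
    (h : sectorRoot q η W = sectorRoot q η' W') : η = η' := by
  have h1 := congrArg (· ^ q) h
  simp only [sectorRoot_pow hq hη, sectorRoot_pow hq hη'] at h1
  have h2 : e * W = e' * W' := by
    apply mul_left_cancel₀ Complex.I_ne_zero
    linear_combination h1
  have h3 : W = W' := by
    rcases he with rfl | rfl <;> rcases he' with rfl | rfl
    · simpa using h2
    · have := congrArg Complex.re h2
      simp at this
      linarith
    · have := congrArg Complex.re h2
      simp at this
      linarith
    · simpa using h2
  subst h3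
  exact mul_right_cancel₀ (root_ne_zero hW) h

theorem sectorRoot_neg : sectorRoot q (-η) W = -sectorRoot q η W := by
  rw [sectorRoot, sectorRoot, neg_mul]

/-- The regions for different directions are disjoint. -/
theorem direction_unique (hp : 1 ≤ p) (hq : 1 ≤ q) {e' η' : ℂ} (he : e = 1 ∨ e = -1)
    (hη : η ^ q = e * Complex.I) (he' : e' = 1 ∨ e' = -1) (hη' : η' ^ q = e' * Complex.I)
    (h : l ∈ shellRegion p q η) (h' : l ∈ shellRegion p q η') : η = η' := by
  obtain ⟨W, hW, rfl⟩ := h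
  obtain ⟨W', hW', hl⟩ := h'
  have hl0 : parameter p q η W ≠ 0 := parameter_ne_zero hq he hη hW.1 (sinh_two_mul_ne_zero hW)
  have hz := sectorRoot_ne_zero hq he hη hW.1
  have hz' := sectorRoot_ne_zero hq he' hη' hW'.1
  rcases Nat.even_or_odd (p * q) with heven | hodd
  · have h1 := isAttractingPoint_of_even hp hq he hη hW heven
    have h2 := isAttractingPoint_of_even hp hq he' hη' hW' heven
    rw [hl] at h2
    have hs : ∀ {e : ℂ}, (e = 1 ∨ e = -1) → e ^ p ≠ 0 := fun he => by
      rw [← norm_pos_iff, norm_of_sign (pow_sign he p)]; exact one_pos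
    have heq := eq_of_attractedTo_singleton
      (h1.attractedTo_freeValue_of_even hp hq hl0 heven (mul_ne_zero (hs he) hz))
      (h2.attractedTo_freeValue_of_even hp hq hl0 heven (mul_ne_zero (hs he') hz'))
    -- The prefactors `e ^ p` become `e ^ (p * q) = 1`.
    have hpow := congrArg (· ^ q) heq
    simp only [mul_pow, sectorRoot_pow hq hη, sectorRoot_pow hq hη', ← pow_mul,
      sign_pow_even he heven, sign_pow_even he' heven, one_mul] at hpow
    have h3 : e * W = e' * W' := by
      apply mul_left_cancel₀ Complex.I_ne_zero
      linear_combination hpow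
    have h4 : e = e' := by
      have h5 := congrArg Complex.re h3
      have := hW.1
      have := hW'.1
      rcases he with rfl | rfl <;> rcases he' with rfl | rfl
      · rfl
      · simp at h5; linarith
      · simp at h5; linarith
      · rfl
    subst h4
    exact eq_of_sectorRoot_eq hq he hη hW.1 he' hη' hW'.1 (mul_left_cancel₀ (hs he) heq)
  · have h1 := attractedTo_sectorRoot_pair hp hq he hη hW
    have h2 := attractedTo_sectorRoot_pair hp hq he' hη' hW'
    rw [hl] at h2
    obtain ⟨x, hx, hx'⟩ := h1.inter_nonempty h2 (toFinite _) (toFinite _) (insert_nonempty _ _)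
      (insert_nonempty _ _)
    have hor : sectorRoot q η W = sectorRoot q η' W' ∨
        sectorRoot q η W = -sectorRoot q η' W' := by
      rcases hx with rfl | hx <;> rcases hx' with hx' | hx'
      · exact Or.inl hx'
      · exact Or.inr hx'
      · right
        rw [mem_singleton_iff] at hx
        rw [← hx', hx, neg_neg]
      · left
        rw [mem_singleton_iff] at hx hx'
        exact neg_injective (hx.symm.trans hx')
    rcases hor with heq | heq
    · exact eq_of_sectorRoot_eq hq he hη hW.1 he' hη' hW'.1 heq
    -- Here `η = -η'`, so `e = -e'`: the same point would be both fixed and sent to its negative.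
    · exfalso
      obtain ⟨hpo, hqo⟩ := Nat.odd_mul.1 hodd
      have he'' : -e' = 1 ∨ -e' = -1 := by rcases he' with rfl | rfl <;> simp
      have hη'' : (-η') ^ q = -e' * Complex.I := by rw [hqo.neg_pow, hη', neg_mul]
      have hηη := eq_of_sectorRoot_eq hq he hη hW.1 he'' hη'' hW'.1
        (heq.trans sectorRoot_neg.symm)
      have hee : e = -e' := by
        rw [hηη, hη''] at hη
        exact (mul_right_cancel₀ Complex.I_ne_zero hη).symm
      have f1 := f_sectorRoot (p := p) hq he hη (sinh_two_mul_ne_zero hW)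
      have f2 := f_sectorRoot (p := p) hq he' hη' (sinh_two_mul_ne_zero hW')
      rw [sign_pow_odd he hpo] at f1
      rw [sign_pow_odd he' hpo, hl] at f2
      rw [heq, f_neg_of_odd hodd, f2, hee] at f1
      have h0 : e' * sectorRoot q η' W' = 0 := by linear_combination -(1 / 2 : ℂ) * f1
      rcases mul_eq_zero.1 h0 with h | h
      · rcases he' with rfl | rfl <;> simp at h
      · exact hz' h

end TanFamily

/-! ### Parameters on the symmetry axes. -/

namespace TanFamily

open Metric Set

variable {p q : ℕ} {l e η W : ℂ}

theorem exists_eq_of_pow_eq (hq : 1 ≤ q) {a : ℂ} {g : Fin q → ℂ} (hinj : Function.Injective g)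
    (hg : ∀ k, g k ^ q = a) (hη : η ^ q = a) : ∃ k, g k = η := by
  classical
  have hsub : Finset.univ.image g ⊆ (Polynomial.nthRoots q a).toFinset := by
    intro x hx
    obtain ⟨k, -, rfl⟩ := Finset.mem_image.1 hx
    rw [Multiset.mem_toFinset, Polynomial.mem_nthRoots hq]
    exact hg k
  have hcard : (Polynomial.nthRoots q a).toFinset.card ≤ (Finset.univ.image g).card := by
    rw [Finset.card_image_of_injective _ hinj, Finset.card_univ, Fintype.card_fin]
    exact (Multiset.toFinset_card_le _).trans (Polynomial.card_nthRoots q a)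
  have heq := Finset.eq_of_subset_of_card_le hsub hcard
  have hmem : η ∈ (Polynomial.nthRoots q a).toFinset := by
    rw [Multiset.mem_toFinset, Polynomial.mem_nthRoots hq]
    exact hη
  rw [← heq] at hmem
  obtain ⟨k, -, hk⟩ := Finset.mem_image.1 hmem
  exact ⟨k, hk⟩

theorem reflect_mul {d : ℂ} (hd : d ≠ 0) (k : ℂ) :
    reflect d (d * k) = d * (starRingEnd ℂ) k := by
  have : (starRingEnd ℂ) d ≠ 0 := (map_ne_zero _).2 hd
  rw [reflect, map_mul]
  field_simp

theorem symmetricAboutAxis_shellRegion (hq : 1 ≤ q) (hη : η ≠ 0) :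
    SymmetricAboutAxis p η (shellRegion p q η) := by
  have hd := rotation_ne_zero (p := p) hη
  rw [SymmetricAboutAxis, shellRegion_eq_image]
  constructor
  · obtain ⟨t, ht, hmem⟩ := exists_pos_mem_parameterRegion (p := p) hq
    exact ⟨_, ⟨t, hmem, rfl⟩, t, ht, mul_comm _ _⟩
  · apply Subset.antisymm
    · rintro _ ⟨_, ⟨k, hk, rfl⟩, rfl⟩
      exact ⟨_, conj_mem_parameterRegion hk, (reflect_mul hd k).symm⟩
    · rintro _ ⟨k, hk, rfl⟩
      refine ⟨_, ⟨_, conj_mem_parameterRegion hk, rfl⟩, ?_⟩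
      rw [reflect_mul hd, Complex.conj_conj]

theorem freeValue_of_mem_axis (hl : l ∈ axis p η) :
    ∃ s : ℝ, 0 < s ∧ freeValue p l = (s : ℂ) * η := by
  obtain ⟨s, hs, rfl⟩ := hl
  refine ⟨s, hs, ?_⟩
  have : Complex.I ^ p ≠ 0 := pow_ne_zero _ Complex.I_ne_zero
  rw [freeValue]
  field_simp

/-- For parameters on the axis, the fixed point lies on the ray through `η`. -/
theorem exists_sectorRoot_real (hp : 1 ≤ p) (hq : 1 ≤ q) (he : e = 1 ∨ e = -1)
    (hη : η ^ q = e * Complex.I) (hl : l ∈ axis p η ∩ shellRegion p q η) :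
    ∃ W ∈ attractingRegion p q, parameter p q η W = l ∧
      ∃ t : ℝ, 0 < t ∧ sectorRoot q η W = t * η := by
  obtain ⟨⟨s, hs, hls⟩, W, hW, hWl⟩ := hl
  have hη0 := direction_ne_zero hq he hη
  have hd := rotation_ne_zero (p := p) hη0
  have hval : valueMap p q W = s := by
    apply mul_left_cancel₀ hd
    rw [mul_comm _ (s : ℂ), ← hls, ← hWl, parameter]
  -- The value is real, so the conjugate of `W` gives the same parameter. The two attracting pairs
  -- must meet, whence `r` equals its conjugate up to sign; `Re r > 0` excludes the minus sign.
  have hW' := conj_mem_attractingRegion hW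
  have hWl' : parameter p q η ((starRingEnd ℂ) W) = l := by
    rw [parameter, valueMap_conj hW.1, hval, Complex.conj_ofReal, ← hval, ← hWl, parameter]
  have h1 := attractedTo_sectorRoot_pair hp hq he hη hW
  have h2 := attractedTo_sectorRoot_pair hp hq he hη hW'
  rw [hWl] at h1
  rw [hWl'] at h2
  obtain ⟨x, hx, hx'⟩ := h1.inter_nonempty h2 (toFinite _) (toFinite _) (insert_nonempty _ _)
    (insert_nonempty _ _)
  set r := W ^ ((q : ℂ)⁻¹) with hr
  have hroot : sectorRoot q η W = η * r := rfl
  have hroot' : sectorRoot q η ((starRingEnd ℂ) W) = η * (starRingEnd ℂ) r := by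
    rw [sectorRoot, conj_root hW.1]
  rw [hroot] at hx
  rw [hroot'] at hx'
  have hpos : 0 < r.re := root_re_pos hq hW.1
  have hor : r = (starRingEnd ℂ) r ∨ r = -(starRingEnd ℂ) r := by
    rcases hx with rfl | hx <;> rcases hx' with hx' | hx'
    · exact Or.inl (mul_left_cancel₀ hη0 hx')
    · right
      apply mul_left_cancel₀ hη0
      rw [mul_neg]; exact hx'
    · right
      apply mul_left_cancel₀ hη0
      rw [mem_singleton_iff] at hx
      rw [mul_neg, ← hx', hx, neg_neg]
    · left
      rw [mem_singleton_iff] at hx hx'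
      exact mul_left_cancel₀ hη0 (neg_injective (hx.symm.trans hx'))
  have hreal : (starRingEnd ℂ) r = r := by
    rcases hor with h | h
    · exact h.symm
    · have := congrArg Complex.re h
      simp only [Complex.neg_re, Complex.conj_re] at this
      linarith
  refine ⟨W, hW, hWl, r.re, hpos, ?_⟩
  rw [hroot, Complex.conj_eq_iff_re.1 hreal, mul_comm]

theorem arg_freeValue (hl : l ∈ axis p η) : (freeValue p l).arg = η.arg := by
  obtain ⟨s, hs, h⟩ := freeValue_of_mem_axis hl
  rw [h, Complex.arg_real_mul _ hs]

theorem arg_neg_freeValue (hl : l ∈ axis p η) : (-freeValue p l).arg = (-η).arg := by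
  obtain ⟨s, hs, h⟩ := freeValue_of_mem_axis hl
  rw [h, ← mul_neg, Complex.arg_real_mul _ hs]

/-- The unique attracting fixed point, for `pq` even and a parameter on the axis. -/
theorem exists_fixed_on_axis_of_even (hp : 1 ≤ p) (hq : 1 ≤ q) (he : e = 1 ∨ e = -1)
    (hη : η ^ q = e * Complex.I) (heven : Even (p * q))
    (hl : l ∈ axis p η ∩ shellRegion p q η) :
    ∃ z : ℂ, {w | IsAttractingPoint p q l 1 w} = {z} ∧ z.arg = (e ^ p * η).arg := by
  obtain ⟨W, hW, rfl, t, ht, hroot⟩ := exists_sectorRoot_real hp hq he hη hl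
  have hs : e ^ p ≠ 0 := by
    rw [← norm_pos_iff, norm_of_sign (pow_sign he p)]; exact one_pos
  refine ⟨_, setOf_isAttractingPoint_of_even hp hq
    (parameter_ne_zero hq he hη hW.1 (sinh_two_mul_ne_zero hW)) heven
    (isAttractingPoint_of_even hp hq he hη hW heven)
    (mul_ne_zero hs (sectorRoot_ne_zero hq he hη hW.1)), ?_⟩
  rw [hroot, mul_left_comm, Complex.arg_real_mul _ ht]

/-- The ray through `η` is invariant under `f` for the parameters on the axis. -/
theorem iterate_freeValue_mem_ray (hη : η ^ q = Complex.I) (hl : l ∈ axis p η) (m : ℕ) :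
    (f p q l)^[m] (freeValue p l) ∈ ray η := by
  induction m with
  | zero => exact freeValue_of_mem_axis hl
  | succ m ih =>
    obtain ⟨y, hy, hym⟩ := ih
    obtain ⟨s, hs, rfl⟩ := hl
    have hpos : 0 < Real.tanh (y ^ q) := by
      rw [Real.tanh_eq_sinh_div_cosh]
      exact div_pos (Real.sinh_pos_iff.2 (by positivity)) (Real.cosh_pos _)
    refine ⟨s * Real.tanh (y ^ q) ^ p, by positivity, ?_⟩
    have hI : Complex.I ^ p ≠ 0 := pow_ne_zero _ Complex.I_ne_zero
    rw [Function.iterate_succ_apply', hym, f, mul_pow, hη, Complex.tan_mul_I, mul_pow]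
    push_cast
    field_simp

/-- The orbit of `v` stays on the ray through `η`, whose points are farther than `t` from `-t * η`.
-/
theorem attractedTo_of_mem_axis (hp : 1 ≤ p) (hq : 1 ≤ q) (hη : η ^ q = Complex.I)
    (hodd : Odd (p * q)) (hl0 : l ≠ 0) (hl : l ∈ axis p η) {t : ℝ} (ht : 0 < t)
    (hz : IsAttractingPoint p q l 1 (t * η)) : AttractedTo p q l (freeValue p l) {(t : ℂ) * η} := by
  have hn : ‖η‖ = 1 := norm_direction hq (Or.inl rfl) (by rw [hη, one_mul])
  have hη0 : η ≠ 0 := by rw [← norm_pos_iff, hn]; exact one_pos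
  have ht0 : (t : ℂ) ≠ 0 := by exact_mod_cast ht.ne'
  refine (hz.attractedTo_freeValue_of_odd hp hq hl0 hodd (mul_ne_zero ht0 hη0)).resolve_right
    fun h => ?_
  obtain ⟨m, hm⟩ := (h.2.eventually (gt_mem_nhds ht)).exists
  obtain ⟨y, hy, hym⟩ := iterate_freeValue_mem_ray hη hl m
  rw [infDist_singleton, hym, dist_eq_norm, sub_neg_eq_add, ← add_mul, norm_mul, hn, mul_one,
    ← Complex.ofReal_add, Complex.norm_of_nonneg (by positivity)] at hm
  linarith

end TanFamily

theorem mainTheorem6 (p q : ℕ) (hp : 1 ≤ p) (hq : 1 ≤ q)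
    (ηp ηm : Fin q → ℂ)
    (hηp_inj : Function.Injective ηp) (hηp : ∀ k, ηp k ^ q = Complex.I)
    (hηm_inj : Function.Injective ηm) (hηm : ∀ k, ηm k ^ q = -Complex.I)
    (hodd : Odd q → ∀ k, ηm k = -ηp k)
    (heven : Even q → ∀ k, ηm k = (starRingEnd ℂ) (ηp k)) :
    ∃ Ωp Ωm : Fin q → Set ℂ,
      -- the `2q` sets are distinct and they are exactly the elements of `S_1`
      Function.Injective (Sum.elim Ωp Ωm) ∧
      TanFamily.shellComponents p q 1 = Set.range (Sum.elim Ωp Ωm) ∧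
      -- each is unbounded and symmetric about its ray
      (∀ k, ¬ Bornology.IsBounded (Ωp k) ∧ TanFamily.SymmetricAboutAxis p (ηp k) (Ωp k)) ∧
      (∀ k, ¬ Bornology.IsBounded (Ωm k) ∧ TanFamily.SymmetricAboutAxis p (ηm k) (Ωm k)) ∧
      (∀ k, ∀ l ∈ TanFamily.axis p (ηp k),
        ∃ s : ℝ, 0 < s ∧ TanFamily.freeValue p l = (s : ℂ) * ηp k) ∧
      (∀ k, ∀ l ∈ TanFamily.axis p (ηm k),
        ∃ s : ℝ, 0 < s ∧ TanFamily.freeValue p l = (s : ℂ) * ηm k) ∧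
      -- `p` even
      (Even p → ∀ k, ∀ l ∈ (TanFamily.axis p (ηp k) ∩ Ωp k) ∪ (TanFamily.axis p (ηm k) ∩ Ωm k),
        ∃ z : ℂ, {w | TanFamily.IsAttractingPoint p q l 1 w} = {z} ∧
          Complex.arg z = Complex.arg (TanFamily.freeValue p l)) ∧
      -- `p` odd and `q` even
      (Odd p → Even q → ∀ k,
        (∀ l ∈ TanFamily.axis p (ηp k) ∩ Ωp k,
          ∃ z : ℂ, {w | TanFamily.IsAttractingPoint p q l 1 w} = {z} ∧
            Complex.arg z = Complex.arg (TanFamily.freeValue p l)) ∧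
        (∀ l ∈ TanFamily.axis p (ηm k) ∩ Ωm k,
          ∃ z : ℂ, {w | TanFamily.IsAttractingPoint p q l 1 w} = {z} ∧
            Complex.arg z = Complex.arg (-TanFamily.freeValue p l))) ∧
      -- `p` and `q` odd
      (Odd (p * q) → ∀ k,
        (∀ l ∈ TanFamily.axis p (ηp k) ∩ Ωp k,
          ∃ z : ℂ, z ≠ -z ∧ {w | TanFamily.IsAttractingPoint p q l 1 w} = {z, -z} ∧
            z ∈ TanFamily.ray (ηp k) ∧ -z ∈ TanFamily.ray (ηm k) ∧
            TanFamily.AttractedTo p q l (TanFamily.freeValue p l) {z} ∧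
            TanFamily.AttractedTo p q l (-TanFamily.freeValue p l) {-z}) ∧
        (∀ l ∈ TanFamily.axis p (ηm k) ∩ Ωm k,
          ∃ z : ℂ, z ≠ -z ∧ {C : Set ℂ | TanFamily.IsAttractingCycle p q l 2 C} = {{z, -z}} ∧
            TanFamily.AttractedTo p q l (TanFamily.freeValue p l) {z, -z} ∧
            TanFamily.AttractedTo p q l (-TanFamily.freeValue p l) {z, -z} ∧
            Complex.arg z = Complex.arg (TanFamily.freeValue p l))) := by
  have dp : ∀ k, ηp k ^ q = 1 * Complex.I := fun k => by rw [hηp, one_mul]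
  have dm : ∀ k, ηm k ^ q = -1 * Complex.I := fun k => by rw [hηm, neg_one_mul]
  have e1 : (1 : ℂ) = 1 ∨ (1 : ℂ) = -1 := Or.inl rfl
  have e2 : (-1 : ℂ) = 1 ∨ (-1 : ℂ) = -1 := Or.inr rfl
  have np : ∀ k, ηp k ≠ 0 := fun k => TanFamily.direction_ne_zero hq e1 (dp k)
  have nm : ∀ k, ηm k ≠ 0 := fun k => TanFamily.direction_ne_zero hq e2 (dm k)
  have hne : ∀ j k, ηp j ≠ ηm k := fun j k h => by
    have h1 := hηp j
    rw [h, hηm] at h1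
    exact TanFamily.ne_neg_self Complex.I_ne_zero h1.symm
  have huniq : ∀ {e e' η η' : ℂ}, (e = 1 ∨ e = -1) → η ^ q = e * Complex.I →
      (e' = 1 ∨ e' = -1) → η' ^ q = e' * Complex.I →
      TanFamily.shellRegion p q η = TanFamily.shellRegion p q η' → η = η' := by
    intro e e' η η' he hη he' hη' h
    obtain ⟨l, hl⟩ := (TanFamily.isConnected_shellRegion (p := p) (η := η) hp hq).nonempty
    exact TanFamily.direction_unique hp hq he hη he' hη' hl (h ▸ hl)
  refine ⟨fun k => TanFamily.shellRegion p q (ηp k), fun k => TanFamily.shellRegion p q (ηm k),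
    ?_, ?_, fun k => ⟨TanFamily.not_isBounded_shellRegion hp hq (np k),
      TanFamily.symmetricAboutAxis_shellRegion hq (np k)⟩,
    fun k => ⟨TanFamily.not_isBounded_shellRegion hp hq (nm k),
      TanFamily.symmetricAboutAxis_shellRegion hq (nm k)⟩,
    fun k l hl => TanFamily.freeValue_of_mem_axis hl,
    fun k l hl => TanFamily.freeValue_of_mem_axis hl, ?_, ?_, ?_⟩
  · rintro (j | j) (k | k) h <;> simp only [Sum.elim_inl, Sum.elim_inr] at h
    · rw [hηp_inj (huniq e1 (dp j) e1 (dp k) h)]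
    · exact absurd (huniq e1 (dp j) e2 (dm k) h) (hne j k)
    · exact absurd (huniq e2 (dm j) e1 (dp k) h).symm (hne k j)
    · rw [hηm_inj (huniq e2 (dm j) e2 (dm k) h)]
  · ext Ω
    rw [TanFamily.mem_shellComponents_iff hp hq]
    constructor
    · rintro ⟨e, η, rfl | rfl, hη, rfl⟩
      · obtain ⟨k, rfl⟩ := TanFamily.exists_eq_of_pow_eq hq hηp_inj dp hη
        exact ⟨Sum.inl k, rfl⟩
      · obtain ⟨k, rfl⟩ := TanFamily.exists_eq_of_pow_eq hq hηm_inj dm hη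
        exact ⟨Sum.inr k, rfl⟩
    · rintro ⟨k | k, rfl⟩
      · exact ⟨1, ηp k, e1, dp k, rfl⟩
      · exact ⟨-1, ηm k, e2, dm k, rfl⟩
  · rintro hpe k l (hl | hl)
    · obtain ⟨z, hz, harg⟩ :=
        TanFamily.exists_fixed_on_axis_of_even hp hq e1 (dp k) (hpe.mul_right q) hl
      exact ⟨z, hz, by rw [harg, one_pow, one_mul, TanFamily.arg_freeValue hl.1]⟩
    · obtain ⟨z, hz, harg⟩ :=
        TanFamily.exists_fixed_on_axis_of_even hp hq e2 (dm k) (hpe.mul_right q) hl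
      exact ⟨z, hz, by rw [harg, hpe.neg_one_pow, one_mul, TanFamily.arg_freeValue hl.1]⟩
  · intro hpo hqe k
    refine ⟨fun l hl => ?_, fun l hl => ?_⟩
    · obtain ⟨z, hz, harg⟩ :=
        TanFamily.exists_fixed_on_axis_of_even hp hq e1 (dp k) (hqe.mul_left p) hl
      exact ⟨z, hz, by rw [harg, one_pow, one_mul, TanFamily.arg_freeValue hl.1]⟩
    · obtain ⟨z, hz, harg⟩ :=
        TanFamily.exists_fixed_on_axis_of_even hp hq e2 (dm k) (hqe.mul_left p) hl
      exact ⟨z, hz, by rw [harg, hpo.neg_one_pow, neg_one_mul, TanFamily.arg_neg_freeValue hl.1]⟩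
  · intro hpq k
    have hk := hodd (Nat.odd_mul.1 hpq).2 k
    refine ⟨fun l hl => ?_, fun l hl => ?_⟩
    · obtain ⟨W, hW, rfl, t, ht, hroot⟩ :=
        TanFamily.exists_sectorRoot_real hp hq e1 (dp k) hl
      have hl0 : TanFamily.parameter p q (ηp k) W ≠ 0 :=
        TanFamily.parameter_ne_zero hq e1 (dp k) hW.1 (TanFamily.sinh_two_mul_ne_zero hW)
      have hz0 := TanFamily.sectorRoot_ne_zero hq e1 (dp k) hW.1
      have hz := TanFamily.isAttractingPoint_of_eq_one hp hq e1 (dp k) hW rfl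
      rw [hroot] at hz0 hz
      have hv := TanFamily.attractedTo_of_mem_axis hp hq (hηp k) hpq hl0 hl.1 ht hz
      exact ⟨_, TanFamily.ne_neg_self hz0,
        TanFamily.setOf_isAttractingPoint_of_odd hp hq hl0 hpq hz hz0, ⟨t, ht, rfl⟩,
        ⟨t, ht, by rw [hk, mul_neg]⟩, hv, hv.neg_singleton hpq⟩
    · obtain ⟨W, hW, rfl, t, ht, hroot⟩ :=
        TanFamily.exists_sectorRoot_real hp hq e2 (dm k) hl
      have hl0 : TanFamily.parameter p q (ηm k) W ≠ 0 :=
        TanFamily.parameter_ne_zero hq e2 (dm k) hW.1 (TanFamily.sinh_two_mul_ne_zero hW)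
      have hz0 := TanFamily.sectorRoot_ne_zero hq e2 (dm k) hW.1
      have hz := TanFamily.isAttractingPoint_of_eq_neg_one hp hq e2 (dm k) hW hpq rfl
      have hv := TanFamily.attractedTo_sectorRoot_pair hp hq e2 (dm k) hW
      refine ⟨_, TanFamily.ne_neg_self hz0,
        TanFamily.setOf_isAttractingCycle_two hp hq hl0 hpq hz hz0, hv, hv.neg_pair hpq, ?_⟩
      rw [hroot, Complex.arg_real_mul _ ht, TanFamily.arg_freeValue hl.1]
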